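/- **Proposition (Criterion for skew-product).** *Conventions.* A probability algebra $Y$ is a $\sigma$-complete Boolean algebra $\mathcal{B}_Y$ with a countably additive probability measure $\mu_Y$ that is positive on nonzero elements. A morphism $T\colon X\to Y$ of probability algebras is a Boolean homomorphism $T^*\colon \mathcal{B}_Y\to \mathcal{B}_X$ with $\mu_X(T^*E)=\mu_Y(E)$ for all $E$. Let $\mathrm{Stone}(Y)$ be the Stone space of $\mathcal{B}_Y$, with the Baire probability measure that gives the clopen set of $E$ the mass $\mu_Y(E)$; its probability algebra (Baire sets modulo null sets) is canonically isomorphic to $Y$, and $T$ induces a continuous measure preserving map $\mathrm{Stone}(T)\colon\mathrm{Stone}(X)\to\mathrm{Stone}(Y)$. Put $L^\infty(Y):=L^\infty(\mathrm{Stone}(Y))$, $\int_Y:=\int_{\mathrm{Stone}(Y)}$ and $\pi^*f:=f\circ\mathrm{Stone}(\pi)$. For a compact Hausdorff space $Z$ (with its Baire $\sigma$-algebra), $\mathrm{Cond}_Y(Z)$ is the set of $\sigma$-homomorphisms from the Baire sets of $Z$ to $\mathcal{B}_Y$. Each $k\in\mathrm{Cond}_Y(Z)$ is represented by a unique continuous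 map $\tilde k\colon \mathrm{Stone}(Y)\to Z$, in the sense that, for every Baire set $A\subseteq Z$, the clopen set of $k(A)$ agrees almost everywhere with $\tilde k^{-1}(A)$; this identifies $\mathrm{Cond}_Y(Z)$ with $C(\mathrm{Stone}(Y),Z)$. For a morphism $T\colon X\to Y$ write $k\circ T := T^*\circ k\in \mathrm{Cond}_X(Z)$, and for $g\in C(Z)$ interpret $g\circ k$ as $g\circ\tilde k\in L^\infty(Y)$. Through this identification $\mathrm{Cond}_Y(K)$ is a group when $K$ is a compact Hausdorff group, and it acts on $\mathrm{Cond}_Y(K/L)$ for each closed subgroup $L$ of $K$ (both pointwise). Let $\Gamma$ be a group. A system is a probability algebra with an action $\gamma\mapsto T^\gamma$ of $\Gamma$ by automorphisms; morphisms of systems are the equivariant morphisms. An extension of a system $Y$ is a system $X$ with a morphism $\pi\colon X\to Y$ of systems; an isomorphism of extensions of $Y$ is an isomorphism of systems that commutes with the maps to $Y$. A $K$-valued cocycle on $Y$ is a family $\rho=(\rho_\gamma)_{\gamma\in\Gamma}$ in $\mathrm{Cond}_Y(K)$ with $\rho_{\gamma\gamma'}=(\rho_\gamma\circ T_Y^{\gamma'})\,\rho_{\gamma'}$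 for all $\gamma,\gamma'\in\Gamma$. The skew-product $Y\rtimes_\rho K/L$ is the probability algebra of $\mathrm{Stone}(Y)\times K/L$ with the product of the measure of $\mathrm{Stone}(Y)$ and the Haar probability measure of $K/L$, with the action induced by $(y,kL)\mapsto(\mathrm{Stone}(T_Y^\gamma)(y),\tilde\rho_\gamma(y)kL)$; it is an extension of $Y$ through the projection to $\mathrm{Stone}(Y)$. A homogeneous extension of $Y$ by $K/L$ is a tuple $(X,\pi,\theta,\rho)$ in which $(X,\pi)$ is an extension of $Y$, $\theta\in\mathrm{Cond}_X(K/L)$, the ranges of $\pi^*$ and $\theta$ together generate $\mathcal{B}_X$ as a $\sigma$-complete Boolean algebra, and $\rho$ is a $K$-valued cocycle on $Y$ with $\theta\circ T_X^\gamma=(\rho_\gamma\circ\pi)\,\theta$ for all $\gamma\in\Gamma$. *Statement.* Let $\Gamma$ be a group, $Y$ a system for $\Gamma$, $K$ a compact Hausdorff group and $L$ a closed subgroup of $K$. Let $(X,\pi,\theta,\rho)$ be a homogeneous extension of $Y$ by $K/L$. Suppose that $$\int_X (\pi^*f)\,(g\circ\theta)=\Big(\int_Y f\Big)\Big(\int_{K/L}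 g\Big)$$ for all $f\in L^\infty(Y)$ and all continuous $g\colon K/L\to\mathbb{C}$, where $K/L$ carries its Haar probability measure. Then $X$ is isomorphic, as an extension of $Y$, to the skew-product $Y\rtimes_\rho K/L$. -/

import Mathlib

open MeasureTheory Set
open scoped ENNReal

universe u v w u₁ u₂ u₃

noncomputable section

namespace MackeyZimmer

/-! ### Probability algebras and their morphisms -/

/-- A probability algebra: a `σ`-complete Boolean algebra with a countably additive probability
measure that is strictly positive on nonzero elements. -/
structure ProbAlg : Type (u + 1) where
  /-- the elements of the algebra -/
  carrier : Type u
  [boolAlg : BooleanAlgebra carrier]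
  sigmaComplete : ∀ s : ℕ → carrier, ∃ a, IsLUB (range s) a
  /-- the measure -/
  μ : carrier → ℝ≥0∞
  μ_bot : μ ⊥ = 0
  μ_top : μ ⊤ = 1
  μ_lub : ∀ (s : ℕ → carrier) (a : carrier), Pairwise (Function.onFun Disjoint s) →
    IsLUB (range s) a → μ a = ∑' n, μ (s n)
  μ_pos : ∀ a, a ≠ ⊥ → 0 < μ a

instance : CoeSort ProbAlg.{u} (Type u) := ⟨ProbAlg.carrier⟩

instance (Y : ProbAlg.{u}) : BooleanAlgebra Y := Y.boolAlg

namespace ProbAlg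

variable {X : ProbAlg.{u₁}} {Y : ProbAlg.{u₂}} {Z : ProbAlg.{u₃}}

lemma μ_sup {a b : Y} (h : Disjoint a b) : Y.μ (a ⊔ b) = Y.μ a + Y.μ b := by
  let s : ℕ → Y := fun n => if n = 0 then a else if n = 1 then b else ⊥
  have hs : IsLUB (range s) (a ⊔ b) := by
    constructor
    · rintro _ ⟨n, rfl⟩
      simp only [s]
      split_ifs <;> simp
    · intro c hc
      have h0 := hc ⟨0, rfl⟩
      have h1 := hc ⟨1, rfl⟩
      simp only [s] at h0 h1
      exact sup_le (by simpa using h0) (by simpa using h1)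
  have hd : Pairwise (Function.onFun Disjoint s) := by
    intro i j hij
    simp only [Function.onFun, s]
    split_ifs with h1 h2 h3 h4 h5 <;> first | omega | exact h | exact h.symm | simp
  rw [Y.μ_lub s _ hd hs, tsum_eq_sum (s := Finset.range 2)]
  · simp [s, Finset.sum_range_succ]
  · intro n hn
    simp only [Finset.mem_range, not_lt] at hn
    have h0 : n ≠ 0 := by omega
    have h1 : n ≠ 1 := by omega
    simp [s, h0, h1, Y.μ_bot]

lemma μ_sdiff_add {a b : Y} (h : a ≤ b) : Y.μ (b \ a) + Y.μ a = Y.μ b := by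
  rw [← μ_sup disjoint_sdiff_self_left, sdiff_sup_cancel h]

lemma μ_mono {a b : Y} (h : a ≤ b) : Y.μ a ≤ Y.μ b := by
  rw [← μ_sdiff_add h]; exact le_add_self

lemma μ_ne_top (a : Y) : Y.μ a ≠ ∞ :=
  ((μ_mono le_top).trans_lt (by rw [Y.μ_top]; exact ENNReal.one_lt_top)).ne

lemma eq_bot_of_μ {a : Y} (h : Y.μ a = 0) : a = ⊥ := by
  by_contra h'
  exact (Y.μ_pos a h').ne' h

lemma eq_of_le_of_μ_le {a b : Y} (h : a ≤ b) (h' : Y.μ b ≤ Y.μ a) : a = b := by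
  refine le_antisymm h ?_
  rw [← sdiff_eq_bot_iff]
  apply eq_bot_of_μ
  have h1 := μ_sdiff_add h
  rw [← le_antisymm h' (μ_mono h)] at h1
  have h2 : Y.μ (b \ a) + Y.μ b = 0 + Y.μ b := by rw [h1, zero_add]
  exact (ENNReal.add_left_inj (μ_ne_top b)).1 h2

lemma μ_finset_sup {ι : Type*} (t : Finset ι) (s : ι → Y)
    (hs : Pairwise (Function.onFun Disjoint s)) : Y.μ (t.sup s) = ∑ i ∈ t, Y.μ (s i) := by
  classical
  induction t using Finset.induction_on with
  | empty => simp [Y.μ_bot]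
  | insert i t hi ih =>
    rw [Finset.sup_insert, Finset.sum_insert hi, μ_sup, ih]
    rw [Finset.disjoint_sup_right]
    intro j hj
    exact hs (fun h => hi (h ▸ hj))

lemma μ_lub_eq_iSup {s : ℕ → Y} {a : Y} (ha : IsLUB (range s) a) :
    Y.μ a = ⨆ n, Y.μ (partialSups s n) := by
  have hps : ∀ n, partialSups s n = (Finset.range (n + 1)).sup (disjointed s) := by
    intro n
    rw [← partialSups_disjointed s, partialSups_eq_sup_range]
  have ha' : IsLUB (range (disjointed s)) a := by
    have h1 : upperBounds (range (disjointed s)) = upperBounds (range s) := by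
      rw [← upperBounds_range_partialSups (disjointed s), partialSups_disjointed,
        upperBounds_range_partialSups]
    unfold IsLUB
    rw [h1]; exact ha
  rw [Y.μ_lub _ a (disjoint_disjointed s) ha']
  rw [ENNReal.tsum_eq_iSup_nat]
  simp_rw [hps, μ_finset_sup _ _ (disjoint_disjointed s)]
  refine le_antisymm (iSup_le fun n => ?_) (iSup_le fun n => le_iSup
    (fun n => ∑ i ∈ Finset.range n, Y.μ (disjointed s i)) (n + 1))
  refine le_iSup_of_le n ?_
  exact Finset.sum_le_sum_of_subset (Finset.range_mono (Nat.le_succ n))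

end ProbAlg

/-- A homomorphism of `σ`-complete Boolean algebras: a Boolean homomorphism that preserves
countable joins (and hence, by complementation, countable meets). -/
structure SigmaHom (A : Type u) (B : Type v) [BooleanAlgebra A] [BooleanAlgebra B]
    extends BoundedLatticeHom A B where
  map_lub : ∀ (s : ℕ → A) (a : A), IsLUB (range s) a →
    IsLUB (range fun n => toFun (s n)) (toFun a)

namespace SigmaHom

variable {A : Type u} {B : Type v} {C : Type w} [BooleanAlgebra A] [BooleanAlgebra B]
  [BooleanAlgebra C]

instance : FunLike (SigmaHom A B) A B where
  coe f := f.toFun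
  coe_injective f g h := by
    cases f; cases g
    congr
    exact DFunLike.coe_injective h

instance : BoundedLatticeHomClass (SigmaHom A B) A B where
  map_sup f := f.map_sup'
  map_inf f := f.map_inf'
  map_top f := f.map_top'
  map_bot f := f.map_bot'

@[ext] lemma ext {f g : SigmaHom A B} (h : ∀ a, f a = g a) : f = g := DFunLike.ext _ _ h

lemma isLUB (f : SigmaHom A B) {s : ℕ → A} {a : A} (h : IsLUB (range s) a) :
    IsLUB (range fun n => f (s n)) (f a) := f.map_lub s a h

/-- Composition of `σ`-homomorphisms. -/
def comp (g : SigmaHom B C) (f : SigmaHom A B) : SigmaHom A C where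
  toBoundedLatticeHom := g.toBoundedLatticeHom.comp f.toBoundedLatticeHom
  map_lub _ _ h := g.map_lub _ _ (f.map_lub _ _ h)

@[simp] lemma comp_apply (g : SigmaHom B C) (f : SigmaHom A B) (a : A) :
    g.comp f a = g (f a) := rfl

end SigmaHom

namespace ProbAlg

/-- A morphism of probability algebras `X → Y`: a measure preserving Boolean homomorphism in the
opposite direction, from the algebra of `Y` to the algebra of `X`. -/
structure Hom (X : ProbAlg.{u}) (Y : ProbAlg.{v}) where
  /-- the homomorphism `E ↦ T^* E` of Boolean algebras -/
  pullback : BoundedLatticeHom Y X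
  map_μ : ∀ E : Y, X.μ (pullback E) = Y.μ E

namespace Hom

variable {X : ProbAlg.{u₁}} {Y : ProbAlg.{u₂}} {Z : ProbAlg.{u₃}}

@[ext] lemma ext {f g : Hom X Y} (h : ∀ E, f.pullback E = g.pullback E) : f = g := by
  cases f; cases g
  congr
  exact DFunLike.ext _ _ h

/-- The identity morphism. -/
def id (X : ProbAlg.{u}) : Hom X X := ⟨BoundedLatticeHom.id X, fun _ => rfl⟩

/-- The composition `S ∘ T` of morphisms `T : X → Y` and `S : Y → Z`. -/
def comp (S : Hom Y Z) (T : Hom X Y) : Hom X Z :=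
  ⟨T.pullback.comp S.pullback, fun E => (T.map_μ _).trans (S.map_μ E)⟩

/-- A morphism of probability algebras automatically preserves countable joins, so it gives a
morphism of abstract probability spaces. -/
def inc (T : Hom X Y) : SigmaHom Y X where
  toBoundedLatticeHom := T.pullback
  map_lub s a h := by
    change IsLUB (range fun n => T.pullback (s n)) (T.pullback a)
    obtain ⟨b, hb⟩ := X.sigmaComplete fun n => T.pullback (s n)
    have hle : b ≤ T.pullback a := by
      refine hb.2 ?_
      rintro _ ⟨n, rfl⟩
      exact OrderHomClass.mono T.pullback (h.1 ⟨n, rfl⟩)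
    have hps : ∀ n, T.pullback (partialSups s n) = partialSups (fun n => T.pullback (s n)) n := by
      intro n
      induction n with
      | zero => simp
      | succ n ih => rw [← Order.succ_eq_add_one, partialSups_succ, partialSups_succ, map_sup, ih]
    have : b = T.pullback a := by
      refine eq_of_le_of_μ_le hle ?_
      rw [T.map_μ, μ_lub_eq_iSup h, μ_lub_eq_iSup hb]
      simp_rw [← hps, T.map_μ]
      exact le_rfl
    rw [← this]
    exact hb

@[simp] lemma inc_apply (T : Hom X Y) (E : Y) : T.inc E = T.pullback E := rfl

end Hom

end ProbAlg

/-! ### The Baire `σ`-algebra -/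

/-- The Baire `σ`-algebra of a topological space, generated by the continuous functions. -/
@[reducible] def baire (K : Type*) [TopologicalSpace K] : MeasurableSpace K :=
  ⨆ f : C(K, ℝ), MeasurableSpace.comap f (borel ℝ)

/-- The Boolean algebra of Baire sets. -/
abbrev BaireSet (K : Type*) [TopologicalSpace K] : Type _ :=
  Subtype (MeasurableSet[baire K])

instance (K : Type*) [TopologicalSpace K] : BooleanAlgebra (BaireSet K) :=
  @MeasurableSet.Subtype.instBooleanAlgebra K (baire K)

section Baire

variable {K : Type*} [TopologicalSpace K] {K' : Type*} [TopologicalSpace K']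

lemma measurable_baire_of_continuous (f : C(K, ℝ)) : Measurable[baire K] f := by
  rw [measurable_iff_comap_le]
  exact le_iSup (fun f : C(K, ℝ) => MeasurableSpace.comap f (borel ℝ)) f

lemma measurable_baire_iff {Ω : Type*} [m : MeasurableSpace Ω] {F : Ω → K} :
    Measurable[m, baire K] F ↔ ∀ g : C(K, ℝ), Measurable fun x => g (F x) := by
  constructor
  · intro h g
    exact (measurable_baire_of_continuous g).comp h
  · intro h
    rw [measurable_iff_comap_le, MeasurableSpace.comap_iSup]
    refine iSup_le fun g => ?_
    rw [MeasurableSpace.comap_comp]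
    exact (h g).comap_le

lemma measurable_baire_baire {F : K → K'} (hF : Continuous F) :
    Measurable[baire K, baire K'] F :=
  (@measurable_baire_iff _ _ _ (baire K) _).2 fun g =>
    measurable_baire_of_continuous (g.comp ⟨F, hF⟩)

lemma baire_le_borel : baire K ≤ borel K := by
  have h := @measurable_baire_iff K _ K (borel K) id
  refine fun A hA => (h.2 fun g => ?_) hA
  have : @BorelSpace K _ (borel K) := @BorelSpace.mk K _ (borel K) rfl
  exact @Continuous.measurable _ _ _ (borel K) _ _ _ _ _ g.continuous

/-- The Baire set `{g ≤ c}`. -/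
def leSet (g : C(K, ℝ)) (c : ℝ) : BaireSet K :=
  ⟨{x | g x ≤ c}, measurable_baire_of_continuous g measurableSet_Iic⟩

lemma baire_eq_generateFrom :
    baire K = MeasurableSpace.generateFrom {A | ∃ (g : C(K, ℝ)) (c : ℝ), A = {x | g x ≤ c}} := by
  apply le_antisymm
  · let _ := MeasurableSpace.generateFrom {A | ∃ (g : C(K, ℝ)) (c : ℝ), A = {x : K | g x ≤ c}}
    refine fun A hA => (measurable_baire_iff (F := id).2 fun g => measurable_of_Iic fun c => ?_) hA
    exact MeasurableSpace.measurableSet_generateFrom ⟨g, c, rfl⟩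
  · apply MeasurableSpace.generateFrom_le
    rintro _ ⟨g, c, rfl⟩
    exact (leSet g c).2

lemma BaireSet.isLUB_iff {s : ℕ → BaireSet K} {a : BaireSet K} :
    IsLUB (range s) a ↔ (a : Set K) = ⋃ n, (s n : Set K) := by
  have hU : IsLUB (range s) ⟨⋃ n, (s n : Set K), MeasurableSet.iUnion fun n => (s n).2⟩ := by
    constructor
    · rintro _ ⟨n, rfl⟩
      exact subset_iUnion (fun n => (s n : Set K)) n
    · intro b hb
      exact iUnion_subset fun n => hb ⟨n, rfl⟩
  constructor
  · intro h
    rw [h.unique hU]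
  · intro h
    have : a = ⟨⋃ n, (s n : Set K), MeasurableSet.iUnion fun n => (s n).2⟩ := Subtype.ext h
    rw [this]; exact hU

/-- The preimage map on Baire sets given by a continuous map. -/
def BaireSet.preimage (F : C(K, K')) : SigmaHom (BaireSet K') (BaireSet K) where
  toFun A := ⟨F ⁻¹' (A : Set K'), measurable_baire_baire F.continuous A.2⟩
  map_sup' _ _ := rfl
  map_inf' _ _ := rfl
  map_top' := rfl
  map_bot' := rfl
  map_lub s a h := by
    rw [BaireSet.isLUB_iff] at h ⊢
    change F ⁻¹' (a : Set K') = ⋃ n, F ⁻¹' (s n : Set K')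
    rw [h, preimage_iUnion]

/-- On compact Hausdorff spaces, continuous functions on a product are measurable for the product
of the Baire `σ`-algebras; that is, the product of the Baire `σ`-algebras is the Baire `σ`-algebra
of the product. -/
lemma baire_prod [CompactSpace K] [T2Space K] [CompactSpace K'] [T2Space K'] :
    baire (K × K') = @Prod.instMeasurableSpace K K' (baire K) (baire K') := by
  let _ := baire K
  let _ := baire K'
  apply le_antisymm
  · refine fun A hA => (measurable_baire_iff (F := id).2 fun g => ?_) hA
    let S : Subalgebra ℝ C(K × K', ℝ) :=
      { carrier := {f | Measurable f}
        mul_mem' := fun {a b} ha hb => Measurable.mul ha hb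
        add_mem' := fun {a b} ha hb => Measurable.add ha hb
        algebraMap_mem' := fun r => measurable_const }
    have hS : S.SeparatesPoints := by
      rintro ⟨x, y⟩ ⟨x', y'⟩ hne
      by_cases hx : x = x'
      · have hy : y ≠ y' := fun h => hne (by rw [hx, h])
        obtain ⟨f, hf⟩ := exists_continuous_zero_one_of_isClosed (isClosed_singleton (x := y))
          (isClosed_singleton (x := y')) (by simpa using hy)
        refine ⟨_, ⟨f.comp ⟨Prod.snd, continuous_snd⟩,
          (measurable_baire_of_continuous f).comp measurable_snd, rfl⟩, ?_⟩
        simp [hf.1 rfl, hf.2.1 rfl]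
      · obtain ⟨f, hf⟩ := exists_continuous_zero_one_of_isClosed (isClosed_singleton (x := x))
          (isClosed_singleton (x := x')) (by simpa using hx)
        refine ⟨_, ⟨f.comp ⟨Prod.fst, continuous_fst⟩,
          (measurable_baire_of_continuous f).comp measurable_fst, rfl⟩, ?_⟩
        simp [hf.1 rfl, hf.2.1 rfl]
    have htop := ContinuousMap.subalgebra_topologicalClosure_eq_top_of_separatesPoints S hS
    have hg : g ∈ closure (S : Set C(K × K', ℝ)) := by
      have : g ∈ S.topologicalClosure := by rw [htop]; trivial
      exact this
    obtain ⟨u, huS, hu⟩ := mem_closure_iff_seq_limit.1 hg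
    refine measurable_of_tendsto_metrizable (f := fun n x => u n x) (fun n => huS n) ?_
    rw [tendsto_pi_nhds]
    intro x
    exact ((continuous_eval_const x).tendsto g).comp hu
  · exact sup_le (measurable_baire_baire continuous_fst).comap_le
      (measurable_baire_baire continuous_snd).comap_le

end Baire

/-! ### The canonical model -/

/-- The Stone space of (the Boolean algebra of) a probability algebra: its points are the Boolean
homomorphisms to the two-element algebra (equivalently, the ultrafilters). -/
structure Stone (Y : ProbAlg.{u}) : Type u where
  /-- the Boolean homomorphism (indicator function of the ultrafilter) -/
  hom : BoundedLatticeHom Y Bool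

namespace Stone

variable {X : ProbAlg.{u₁}} {Y : ProbAlg.{u₂}} {Z : ProbAlg.{u₃}}

/-- The basic clopen set of the Stone space attached to `E`. -/
def clopen (E : Y) : Set (Stone Y) := {u | u.hom E = true}

instance : TopologicalSpace (Stone Y) := TopologicalSpace.generateFrom (range (clopen (Y := Y)))

instance : MeasurableSpace (Stone Y) := baire (Stone Y)

lemma mem_clopen {E : Y} {u : Stone Y} :
    u ∈ clopen E ↔ u.hom E = true := Iff.rfl

@[ext] lemma ext {u v : Stone Y} (h : ∀ E, u ∈ clopen E ↔ v ∈ clopen E) : u = v := by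
  cases u; cases v
  congr
  exact DFunLike.ext _ _ fun E => Bool.eq_iff_iff.2 (h E)

@[simp] lemma clopen_bot : clopen (⊥ : Y) = ∅ := by
  ext u; rw [mem_clopen, map_bot]; simp

@[simp] lemma clopen_top : clopen (⊤ : Y) = univ := by
  ext u; rw [mem_clopen, map_top]; simp

lemma clopen_sup (E F : Y) : clopen (E ⊔ F) = clopen E ∪ clopen F := by
  ext u; rw [mem_union, mem_clopen, mem_clopen, mem_clopen, map_sup]; simp

lemma clopen_inf (E F : Y) : clopen (E ⊓ F) = clopen E ∩ clopen F := by
  ext u; rw [mem_inter_iff, mem_clopen, mem_clopen, mem_clopen, map_inf]; simp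

lemma clopen_compl (E : Y) : clopen Eᶜ = (clopen E)ᶜ := by
  ext u; rw [mem_compl_iff, mem_clopen, mem_clopen, map_compl']; simp

lemma clopen_sdiff (E F : Y) : clopen (E \ F) = clopen E \ clopen F := by
  rw [sdiff_eq (x := E), clopen_inf, clopen_compl]; rfl

lemma clopen_mono {E F : Y} (h : E ≤ F) : clopen E ⊆ clopen F := by
  rw [← sup_eq_right.2 h, clopen_sup]; exact subset_union_left

lemma clopen_nonempty {E : Y} (hE : E ≠ ⊥) : (clopen E).Nonempty := by
  have hd : Disjoint ((Order.PFilter.principal E : Order.PFilter Y) : Set Y)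
      ((Order.Ideal.principal ⊥ : Order.Ideal Y) : Set Y) := by
    rw [Set.disjoint_left]
    intro a ha hb
    have ha' : E ≤ a := ha
    have hb' : a ≤ ⊥ := hb
    exact hE (le_bot_iff.1 (ha'.trans hb'))
  obtain ⟨J, hJ, -, hJd⟩ := DistribLattice.prime_ideal_of_disjoint_filter_ideal hd
  classical
  have htop : (⊤ : Y) ∉ J := fun h => Set.disjoint_left.1 hJd (show E ≤ ⊤ from le_top) h
  refine ⟨⟨{ toFun := fun a => decide (a ∉ J)
             map_sup' := ?_, map_inf' := ?_, map_top' := ?_, map_bot' := ?_ }⟩, ?_⟩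
  · intro a b
    rw [Bool.eq_iff_iff]
    simp only [decide_eq_true_eq, Bool.max_eq_or, Bool.or_eq_true, Order.Ideal.sup_mem_iff]
    tauto
  · intro a b
    rw [Bool.eq_iff_iff]
    simp only [decide_eq_true_eq, Bool.min_eq_and, Bool.and_eq_true]
    constructor
    · intro h
      exact ⟨fun ha => h (J.lower inf_le_left ha), fun hb => h (J.lower inf_le_right hb)⟩
    · rintro ⟨ha, hb⟩ h
      exact (hJ.mem_or_mem h).elim ha hb
  · simpa using htop
  · simp
  · have : E ∉ J := fun h => Set.disjoint_left.1 hJd (show E ≤ E from le_rfl) h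
    exact decide_eq_true this

lemma clopen_subset_iff {E F : Y} : clopen E ⊆ clopen F ↔ E ≤ F := by
  refine ⟨fun h => ?_, clopen_mono⟩
  by_contra hEF
  rw [← sdiff_eq_bot_iff] at hEF
  obtain ⟨u, hu⟩ := clopen_nonempty hEF
  rw [clopen_sdiff] at hu
  exact hu.2 (h hu.1)

lemma clopen_injective : Function.Injective (clopen (Y := Y)) := fun _ _ h =>
  le_antisymm (clopen_subset_iff.1 h.le) (clopen_subset_iff.1 h.ge)

lemma isOpen_clopen (E : Y) : IsOpen (clopen E) :=
  TopologicalSpace.isOpen_generateFrom_of_mem ⟨E, rfl⟩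

lemma isClopen_clopen (E : Y) : IsClopen (clopen E) :=
  ⟨by rw [← isOpen_compl_iff, ← clopen_compl]; exact isOpen_clopen _, isOpen_clopen E⟩

lemma isTopologicalBasis : TopologicalSpace.IsTopologicalBasis (range (clopen (Y := Y))) where
  exists_subset_inter := by
    rintro _ ⟨E, rfl⟩ _ ⟨F, rfl⟩ u hu
    exact ⟨_, ⟨E ⊓ F, rfl⟩, by rwa [clopen_inf], by rw [clopen_inf]⟩
  sUnion_eq := eq_univ_of_forall fun u => ⟨_, ⟨⊤, rfl⟩, by simp⟩
  eq_generateFrom := rfl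

instance : CompactSpace (Stone Y) where
  isCompact_univ := by
    classical
    rw [isCompact_iff_ultrafilter_le_nhds]
    intro 𝓕 _
    let u : Stone Y :=
      ⟨{
        toFun := fun E => decide (clopen E ∈ 𝓕)
        map_sup' := fun a b => by
          rw [Bool.eq_iff_iff]
          simp [clopen_sup, Ultrafilter.union_mem_iff]
        map_inf' := fun a b => by
          rw [Bool.eq_iff_iff]
          simp only [clopen_inf, decide_eq_true_eq, Bool.min_eq_and, Bool.and_eq_true]
          exact Filter.inter_mem_iff
        map_top' := by
          rw [clopen_top]
          exact decide_eq_true Filter.univ_mem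
        map_bot' := by simp }⟩
    refine ⟨u, mem_univ _, ?_⟩
    rw [TopologicalSpace.nhds_generateFrom]
    refine le_iInf₂ fun s hs => ?_
    obtain ⟨hus, E, rfl⟩ := hs
    rw [Filter.le_principal_iff]
    exact of_decide_eq_true hus

instance : T2Space (Stone Y) where
  t2 u v huv := by
    by_contra hcon
    apply huv
    have key : ∀ (a b : Stone Y), (¬ ∃ U V : Set (Stone Y), IsOpen U ∧ IsOpen V ∧ a ∈ U ∧ b ∈ V ∧
        Disjoint U V) → ∀ E, a ∈ clopen E → b ∈ clopen E := by
      intro a b h E ha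
      by_contra hb
      exact h ⟨clopen E, clopen Eᶜ, isOpen_clopen _, isOpen_clopen _, ha,
        by rw [clopen_compl]; exact hb, by rw [clopen_compl]; exact disjoint_compl_right⟩
    ext E
    refine ⟨key u v hcon E, key v u ?_ E⟩
    rintro ⟨U, V, h1, h2, h3, h4, h5⟩
    exact hcon ⟨V, U, h2, h1, h4, h3, h5.symm⟩

/-- A compact set inside an open set is separated from its complement by a basic clopen set. -/
lemma exists_clopen_between {C U : Set (Stone Y)} (hC : IsCompact C) (hU : IsOpen U)
    (h : C ⊆ U) : ∃ E : Y, C ⊆ clopen E ∧ clopen E ⊆ U := by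
  refine hC.induction_on (p := fun C => ∃ E : Y, C ⊆ clopen E ∧ clopen E ⊆ U) ?_ ?_ ?_ ?_
  · exact ⟨⊥, by simp, by simp⟩
  · rintro s t hst ⟨E, h1, h2⟩
    exact ⟨E, hst.trans h1, h2⟩
  · rintro s t ⟨E, h1, h2⟩ ⟨F, h3, h4⟩
    refine ⟨E ⊔ F, ?_, ?_⟩ <;> rw [clopen_sup]
    · exact union_subset_union h1 h3
    · exact union_subset h2 h4
  · intro u hu
    obtain ⟨_, ⟨E, rfl⟩, hE, hEU⟩ := isTopologicalBasis.exists_subset_of_mem_open (h hu) hU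
    exact ⟨clopen E, mem_nhdsWithin_of_mem_nhds ((isOpen_clopen E).mem_nhds hE), E,
      subset_rfl, hEU⟩

lemma measurableSet_clopen (E : Y) : MeasurableSet (clopen E) := by
  classical
  let g : C(Stone Y, ℝ) := ⟨(clopen E).indicator fun _ => (1 : ℝ),
    Continuous.indicator (f := fun _ : Stone Y => (1 : ℝ))
      (by simp [(isClopen_clopen E).frontier_eq]) continuous_const⟩
  have : clopen E = {x | 1 ≤ g x} := by
    ext x
    by_cases hx : x ∈ clopen E <;> simp [g, hx]
  rw [this]
  exact measurable_baire_of_continuous g measurableSet_Ici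

lemma baire_eq_generateFrom_clopen :
    baire (Stone Y) = MeasurableSpace.generateFrom (range (clopen (Y := Y))) := by
  apply le_antisymm
  · rw [baire_eq_generateFrom]
    apply MeasurableSpace.generateFrom_le
    rintro _ ⟨g, c, rfl⟩
    have h : ∀ n : ℕ, ∃ E : Y, {x | g x ≤ c} ⊆ clopen E ∧
        clopen E ⊆ {x | g x < c + 1 / ((n : ℝ) + 1)} := fun n =>
      exists_clopen_between (isClosed_le g.continuous continuous_const).isCompact
        (isOpen_lt g.continuous continuous_const) fun x hx =>
        by
          have h0 : (0 : ℝ) < 1 / ((n : ℝ) + 1) := by positivity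
          exact lt_of_le_of_lt (show g x ≤ c from hx) (lt_add_of_pos_right _ h0)
    choose E h1 h2 using h
    have : {x | g x ≤ c} = ⋂ n, clopen (E n) := by
      refine Subset.antisymm (subset_iInter h1) fun x hx => ?_
      rw [mem_iInter] at hx
      have hlim : Filter.Tendsto (fun n : ℕ => c + 1 / ((n : ℝ) + 1)) Filter.atTop (nhds (c + 0)) :=
        tendsto_const_nhds.add tendsto_one_div_add_atTop_nhds_zero_nat
      rw [add_zero] at hlim
      exact ge_of_tendsto' hlim fun n => (h2 n (hx n)).le
    rw [this]
    exact MeasurableSet.iInter fun n => MeasurableSpace.measurableSet_generateFrom ⟨_, rfl⟩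
  · apply MeasurableSpace.generateFrom_le
    rintro _ ⟨E, rfl⟩
    exact measurableSet_clopen E

lemma isSetRing : IsSetRing (range (clopen (Y := Y))) where
  empty_mem := ⟨⊥, clopen_bot⟩
  union_mem := by rintro _ _ ⟨E, rfl⟩ ⟨F, rfl⟩; exact ⟨E ⊔ F, clopen_sup E F⟩
  sdiff_mem := by rintro _ _ ⟨E, rfl⟩ ⟨F, rfl⟩; exact ⟨E \ F, clopen_sdiff E F⟩

lemma clopen_finset_sup {ι : Type*} (t : Finset ι) (s : ι → Y) :
    clopen (t.sup s) = ⋃ i ∈ t, clopen (s i) := by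
  classical
  induction t using Finset.induction_on with
  | empty => simp
  | insert i t hi ih => rw [Finset.sup_insert, clopen_sup, ih, Finset.set_biUnion_insert]

/-- The content on basic clopen sets given by the measure of the probability algebra. -/
def content (Y : ProbAlg.{u}) : AddContent ℝ≥0∞ (range (clopen (Y := Y))) where
  toFun s := Y.μ (Function.invFun clopen s)
  empty' := by
    rw [← clopen_bot (Y := Y), Function.leftInverse_invFun clopen_injective, Y.μ_bot]
  sUnion' I hI hd _ := by
    classical
    have hinv : ∀ s ∈ I, clopen (Function.invFun clopen s) = s := fun s hs =>
      Function.invFun_eq (hI hs)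
    have key : ∀ J ⊆ I, Y.μ (Function.invFun clopen (⋃₀ (J : Set (Set (Stone Y))))) =
        ∑ s ∈ J, Y.μ (Function.invFun clopen s) := by
      intro J
      induction J using Finset.induction_on with
      | empty =>
        intro _
        simp only [Finset.coe_empty, sUnion_empty, Finset.sum_empty]
        rw [← clopen_bot (Y := Y), Function.leftInverse_invFun clopen_injective, Y.μ_bot]
      | insert s J hs ih =>
        intro hJI
        have hsI := hJI (Finset.mem_insert_self s J)
        have hJ : J ⊆ I := (Finset.subset_insert s J).trans hJI
        have hU : ⋃₀ (J : Set (Set (Stone Y))) ∈ range (clopen (Y := Y)) := by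
          refine ⟨J.sup (Function.invFun clopen), ?_⟩
          rw [clopen_finset_sup, sUnion_eq_biUnion]
          exact iUnion₂_congr fun i hi => hinv i (hJ hi)
        have hUc := Function.invFun_eq hU
        have hU' : ⋃₀ ((insert s J : Finset (Set (Stone Y))) : Set (Set (Stone Y))) ∈
            range (clopen (Y := Y)) := by
          obtain ⟨E, hE⟩ := hI hsI
          obtain ⟨F, hF⟩ := hU
          exact ⟨E ⊔ F, by rw [clopen_sup, Finset.coe_insert, sUnion_insert, hE, hF]⟩
        have hUc' := Function.invFun_eq hU'
        rw [Finset.sum_insert hs, ← ih hJ, ← ProbAlg.μ_sup]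
        · congr 1
          apply clopen_injective
          rw [clopen_sup, hinv s hsI, hUc, hUc', Finset.coe_insert, sUnion_insert]
        · rw [disjoint_iff_inf_le, ← clopen_subset_iff, clopen_inf, hinv s hsI, hUc, clopen_bot]
          rintro x ⟨hx, t, ht, hxt⟩
          have hne : s ≠ t := fun h => hs (h ▸ ht)
          exact Set.disjoint_left.1 (hd hsI (hJ ht) hne) hx hxt
    exact key I subset_rfl

lemma content_clopen (E : Y) : content Y (clopen E) = Y.μ E := by
  change Y.μ (Function.invFun clopen (clopen E)) = _
  rw [Function.leftInverse_invFun clopen_injective]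

lemma content_subadditive (Y : ProbAlg.{u}) : (content Y).IsSigmaSubadditive := by
  intro f hf hU
  choose E hE using hf
  obtain ⟨F, hF⟩ := hU
  obtain rfl : f = fun n => clopen (E n) := funext fun n => (hE n).symm
  have hc : IsCompact (clopen F) := (isClopen_clopen F).isClosed.isCompact
  obtain ⟨t, ht⟩ := hc.elim_finite_subcover (fun n => clopen (E n)) (fun n => isOpen_clopen _)
    hF.le
  rw [← clopen_finset_sup, clopen_subset_iff] at ht
  rw [← hF]
  simp_rw [content_clopen]
  refine (ProbAlg.μ_mono ht).trans (le_trans ?_ (ENNReal.sum_le_tsum t))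
  classical
  clear ht
  induction t using Finset.induction_on with
  | empty => simp [Y.μ_bot]
  | insert i t hi ih =>
    rw [Finset.sup_insert, Finset.sum_insert hi]
    have : E i ⊔ t.sup E = E i ⊔ (t.sup E \ E i) := (sup_sdiff_self_right _ _).symm
    rw [this, ProbAlg.μ_sup disjoint_sdiff_self_right]
    exact add_le_add le_rfl ((ProbAlg.μ_mono sdiff_le).trans ih)

/-- The Baire probability measure of the canonical model: it is the unique Baire measure that
gives the clopen set attached to `E` the measure `μ E`. -/
def measure (Y : ProbAlg.{u}) : Measure (Stone Y) :=
  (content Y).measure isSetRing.isSetSemiring baire_eq_generateFrom_clopen.le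
    (content_subadditive Y)

@[simp] lemma measure_clopen (E : Y) : measure Y (clopen E) = Y.μ E := by
  rw [measure, AddContent.measure_eq _ _ baire_eq_generateFrom_clopen _ ⟨E, rfl⟩, content_clopen]

instance : IsProbabilityMeasure (measure Y) :=
  ⟨by rw [← clopen_top, measure_clopen, Y.μ_top]⟩

/-- The canonical model functor on morphisms. -/
def map (T : ProbAlg.Hom X Y) : C(Stone X, Stone Y) where
  toFun u := ⟨u.hom.comp T.pullback⟩
  continuous_toFun := by
    rw [continuous_generateFrom_iff]
    rintro _ ⟨E, rfl⟩
    exact isOpen_clopen (T.pullback E)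

lemma map_mem_clopen (T : ProbAlg.Hom X Y) {u : Stone X} {E : Y} :
    map T u ∈ clopen E ↔ u ∈ clopen (T.pullback E) := Iff.rfl

lemma map_comp (S : ProbAlg.Hom Y Z) (T : ProbAlg.Hom X Y) (u : Stone X) :
    map (S.comp T) u = map S (map T u) := rfl

lemma map_id (u : Stone X) : map (ProbAlg.Hom.id X) u = u := rfl

lemma measurePreserving_map (T : ProbAlg.Hom X Y) :
    MeasurePreserving (map T) (measure X) (measure Y) := by
  have hm : Measurable (map T) := measurable_baire_baire (map T).continuous
  refine ⟨hm, ?_⟩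
  have : IsProbabilityMeasure ((measure X).map (map T)) :=
    Measure.isProbabilityMeasure_map hm.aemeasurable
  refine ext_of_generate_finite (range clopen) baire_eq_generateFrom_clopen ?_ ?_ (by simp)
  · rintro _ ⟨E, rfl⟩ _ ⟨F, rfl⟩ _
    exact ⟨E ⊓ F, clopen_inf E F⟩
  · rintro _ ⟨E, rfl⟩
    rw [Measure.map_apply hm (measurableSet_clopen E), measure_clopen]
    exact (measure_clopen (T.pullback E)).trans (T.map_μ E)

end Stone

/-! ### Conditional elements and their canonical representations -/

namespace Stone

variable {X : ProbAlg.{u₁}} {Y : ProbAlg.{u₂}}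

lemma eq_bot_of_measure {E : Y} (h : measure Y (clopen E) = 0) : E = ⊥ :=
  ProbAlg.eq_bot_of_μ ((measure_clopen E).symm.trans h)

lemma le_of_ae_le {E F : Y} (h : clopen E ≤ᵐ[measure Y] clopen F) : E ≤ F := by
  rw [← sdiff_eq_bot_iff]
  apply eq_bot_of_measure
  rw [clopen_sdiff]
  exact ae_le_set.1 h

lemma eq_of_ae_eq {E F : Y} (h : clopen E =ᵐ[measure Y] clopen F) : E = F :=
  le_antisymm (le_of_ae_le h.le) (le_of_ae_le h.symm.le)

lemma clopen_ae_eq_of_isLUB {s : ℕ → Y} {a : Y} (h : IsLUB (range s) a) :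
    (⋃ n, clopen (s n) : Set (Stone Y)) =ᵐ[measure Y] clopen a := by
  have hsub : (⋃ n, clopen (s n) : Set (Stone Y)) ⊆ clopen a :=
    iUnion_subset fun n => clopen_mono (h.1 ⟨n, rfl⟩)
  refine ae_eq_of_subset_of_measure_ge hsub ?_
    (MeasurableSet.iUnion fun n => measurableSet_clopen _).nullMeasurableSet (measure_ne_top _ _)
  rw [measure_clopen, ProbAlg.μ_lub_eq_iSup h]
  refine iSup_le fun n => ?_
  rw [← measure_clopen]
  refine measure_mono ?_
  rw [partialSups_eq_sup_range, clopen_finset_sup]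
  exact iUnion₂_subset fun i _ => subset_iUnion (fun n => clopen (s n)) i

lemma exists_clopen_ae_eq {A : Set (Stone Y)} (hA : MeasurableSet A) :
    ∃ E : Y, A =ᵐ[measure Y] clopen E := by
  have hA' : MeasurableSet[MeasurableSpace.generateFrom (range (clopen (Y := Y)))] A := by
    rw [← baire_eq_generateFrom_clopen]; exact hA
  clear hA
  induction A, hA' using MeasurableSpace.generateFrom_induction with
  | hC t ht _ =>
    obtain ⟨E, rfl⟩ := ht
    exact ⟨E, Filter.EventuallyEq.rfl⟩
  | empty => exact ⟨⊥, by rw [clopen_bot]; rfl⟩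
  | compl t _ ih =>
    obtain ⟨E, hE⟩ := ih
    exact ⟨Eᶜ, by rw [clopen_compl]; exact hE.compl⟩
  | iUnion t _ ih =>
    choose E hE using ih
    obtain ⟨a, ha⟩ := Y.sigmaComplete E
    exact ⟨a, (Filter.EventuallyEq.countable_iUnion hE).trans (clopen_ae_eq_of_isLUB ha)⟩

/-- The element of the algebra whose clopen set agrees almost everywhere with a given Baire set. -/
def toElem (A : BaireSet (Stone Y)) : Y := (exists_clopen_ae_eq A.2).choose

lemma ae_eq_toElem (A : BaireSet (Stone Y)) :
    (A : Set (Stone Y)) =ᵐ[measure Y] clopen (toElem A) := (exists_clopen_ae_eq A.2).choose_spec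

lemma toElem_eq {A : BaireSet (Stone Y)} {E : Y}
    (h : (A : Set (Stone Y)) =ᵐ[measure Y] clopen E) : toElem A = E :=
  eq_of_ae_eq ((ae_eq_toElem A).symm.trans h)

/-- The canonical inclusion of the abstract probability space of `Y` into its canonical model,
i.e. the `σ`-homomorphism from the Baire sets of the Stone space to `Y` which sends a Baire set
to the unique element of `Y` whose clopen set agrees with it almost everywhere. -/
def incl (Y : ProbAlg.{u}) : SigmaHom (BaireSet (Stone Y)) Y where
  toFun := toElem
  map_sup' A B := toElem_eq <| by
    rw [clopen_sup]; exact (ae_eq_toElem A).union (ae_eq_toElem B)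
  map_inf' A B := toElem_eq <| by
    rw [clopen_inf]; exact (ae_eq_toElem A).inter (ae_eq_toElem B)
  map_top' := toElem_eq <| by rw [clopen_top]; rfl
  map_bot' := toElem_eq <| by rw [clopen_bot]; rfl
  map_lub s a h := by
    obtain ⟨b, hb⟩ := Y.sigmaComplete fun n => toElem (s n)
    have : toElem a = b := by
      apply toElem_eq
      rw [BaireSet.isLUB_iff.1 h]
      exact (Filter.EventuallyEq.countable_iUnion fun n => ae_eq_toElem (s n)).trans
        (clopen_ae_eq_of_isLUB hb)
    rw [this]; exact hb

lemma ae_eq_incl (A : BaireSet (Stone Y)) :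
    (A : Set (Stone Y)) =ᵐ[measure Y] clopen (incl Y A) := ae_eq_toElem A

lemma incl_eq {A : BaireSet (Stone Y)} {E : Y}
    (h : (A : Set (Stone Y)) =ᵐ[measure Y] clopen E) : incl Y A = E := toElem_eq h

/-- The clopen set of the element represented by a closed Baire set is contained in that set. -/
lemma clopen_incl_subset {A : BaireSet (Stone Y)} (hA : IsClosed (A : Set (Stone Y))) :
    clopen (incl Y A) ⊆ A := by
  intro u hu
  by_contra huA
  obtain ⟨_, ⟨E, rfl⟩, huE, hE⟩ := isTopologicalBasis.exists_subset_of_mem_open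
    (show u ∈ clopen (incl Y A) ∩ (A : Set (Stone Y))ᶜ from ⟨hu, huA⟩)
    ((isOpen_clopen _).inter hA.isOpen_compl)
  have h0 : measure Y (clopen E) = 0 := by
    refine measure_mono_null hE ?_
    exact ae_le_set.1 (ae_eq_incl A).symm.le
  rw [eq_bot_of_measure h0, clopen_bot] at huE
  exact huE

end Stone

/-- The conditional elements of a topological space `K` (with its Baire `σ`-algebra) over a
probability algebra `Y`: morphisms `Y → K` of abstract measurable spaces, i.e.
`σ`-homomorphisms from the Baire sets of `K` to `Y`. -/
abbrev Cond (Y : ProbAlg.{u}) (K : Type v) [TopologicalSpace K] : Type (max u v) :=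
  SigmaHom (BaireSet K) Y

namespace Cond

variable {X : ProbAlg.{u₁}} {Y : ProbAlg.{u₂}} {Z : ProbAlg.{u₃}}
variable {K : Type v} [TopologicalSpace K] {K' : Type w} [TopologicalSpace K']

/-- Base change `k ↦ k ∘ T` of conditional elements along a morphism `T : X → Y`. -/
def baseChange (k : Cond Y K) (T : X.Hom Y) : Cond X K := T.inc.comp k

/-- The conditional element `F ∘ k` of `K'`, for a conditional element `k` of `K` and a continuous
map `F : K → K'`. -/
def map (F : C(K, K')) (k : Cond Y K) : Cond Y K' := k.comp (BaireSet.preimage F)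

/-- The defining property of the value at `u` of the canonical representation. -/
lemma exists_rep [CompactSpace K] (k : Cond Y K) (u : Stone Y) :
    ∃ x : K, ∀ (g : C(K, ℝ)) (c : ℝ), u ∈ Stone.clopen (k (leSet g c)) → g x ≤ c := by
  by_contra hcon
  push Not at hcon
  choose g c hu hlt using hcon
  obtain ⟨t, ht⟩ := isCompact_univ.elim_finite_subcover (fun x : K => {y | c x < g x y})
    (fun x => isOpen_lt continuous_const (g x).continuous) fun x _ => mem_iUnion.2 ⟨x, hlt x⟩
  classical
  have h1 : ∀ s : Finset K, u ∈ Stone.clopen (k (s.inf fun x => leSet (g x) (c x))) := by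
    intro s
    induction s using Finset.induction_on with
    | empty => rw [Finset.inf_empty, map_top, Stone.clopen_top]; trivial
    | insert a s _ ih =>
      rw [Finset.inf_insert, map_inf, Stone.clopen_inf]
      exact ⟨hu a, ih⟩
  have h2 : (t.inf fun x => leSet (g x) (c x)) = ⊥ := by
    apply Subtype.ext
    refine Set.eq_empty_of_forall_notMem fun y hy => ?_
    obtain ⟨x, hx⟩ := mem_iUnion.1 (ht (mem_univ y))
    obtain ⟨hxt, hxy⟩ := mem_iUnion.1 hx
    have h3 : (t.inf fun x => leSet (g x) (c x)) ≤ leSet (g x) (c x) := Finset.inf_le hxt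
    have h4 : g x y ≤ c x := h3 hy
    exact absurd h4 (not_le.2 hxy)
  have := h1 t
  rw [h2, map_bot, Stone.clopen_bot] at this
  exact this

lemma mem_clopen_of_lt (k : Cond Y K) {u : Stone Y} {x : K}
    (hx : ∀ (g : C(K, ℝ)) (c : ℝ), u ∈ Stone.clopen (k (leSet g c)) → g x ≤ c)
    (g : C(K, ℝ)) {c : ℝ} (h : g x < c) : u ∈ Stone.clopen (k (leSet g c)) := by
  by_contra hu
  have hcov : leSet g c ⊔ leSet (-g) (-c) = ⊤ := by
    apply Subtype.ext
    refine Set.eq_univ_of_forall fun y => ?_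
    rcases le_total (g y) c with h | h
    · exact Or.inl h
    · exact Or.inr (neg_le_neg h)
  have hu' : u ∈ Stone.clopen (k (leSet (-g) (-c))) := by
    have : u ∈ Stone.clopen (k (leSet g c ⊔ leSet (-g) (-c))) := by
      rw [hcov, map_top, Stone.clopen_top]; trivial
    rw [map_sup, Stone.clopen_sup] at this
    exact this.resolve_left hu
  have := hx (-g) (-c) hu'
  rw [ContinuousMap.neg_apply] at this
  linarith

variable [CompactSpace K] [T2Space K]

lemma rep_unique (k : Cond Y K) {u : Stone Y} {x y : K}
    (hx : ∀ (g : C(K, ℝ)) (c : ℝ), u ∈ Stone.clopen (k (leSet g c)) → g x ≤ c)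
    (hy : ∀ (g : C(K, ℝ)) (c : ℝ), u ∈ Stone.clopen (k (leSet g c)) → g y ≤ c) : x = y := by
  by_contra hne
  obtain ⟨f, hf0, hf1, -⟩ := exists_continuous_zero_one_of_isClosed (isClosed_singleton (x := x))
    (isClosed_singleton (x := y)) (by simpa using hne)
  have h0 : f x = 0 := hf0 rfl
  have h1 : f y = 1 := hf1 rfl
  have := hy f (1 / 2) (mem_clopen_of_lt k hx f (by rw [h0]; norm_num))
  rw [h1] at this
  norm_num at this

/-- The canonical representation of a conditional element of a compact Hausdorff space as a
continuous map on the canonical model; see `incl_preimage_rep` and `condEquiv` for its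
characteristic property. -/
def rep (k : Cond Y K) : C(Stone Y, K) where
  toFun u := (exists_rep k u).choose
  continuous_toFun := by
    rw [continuous_iff_continuousAt]
    intro u
    rw [ContinuousAt, Filter.tendsto_def]
    intro V hV
    obtain ⟨W, hWV, hWo, huW⟩ := mem_nhds_iff.1 hV
    have hs := fun v => (exists_rep k v).choose_spec
    obtain ⟨f, hf0, hf1, -⟩ := exists_continuous_zero_one_of_isClosed
      (isClosed_singleton (x := (exists_rep k u).choose)) hWo.isClosed_compl
      (by simpa using huW)
    have h0 : f (exists_rep k u).choose = 0 := hf0 rfl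
    have hu := mem_clopen_of_lt k (hs u) f (c := 1 / 2) (by rw [h0]; norm_num)
    refine Filter.mem_of_superset ((Stone.isOpen_clopen _).mem_nhds hu) fun v hv => hWV ?_
    by_contra hvW
    have h1 : f (exists_rep k v).choose = 1 := hf1 hvW
    have h2 := hs v f (1 / 2) hv
    rw [h1] at h2
    norm_num at h2

lemma rep_spec (k : Cond Y K) (u : Stone Y) (g : C(K, ℝ)) (c : ℝ)
    (h : u ∈ Stone.clopen (k (leSet g c))) : g (k.rep u) ≤ c :=
  (exists_rep k u).choose_spec g c h

lemma rep_eq (k : Cond Y K) {u : Stone Y} {x : K}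
    (hx : ∀ (g : C(K, ℝ)) (c : ℝ), u ∈ Stone.clopen (k (leSet g c)) → g x ≤ c) :
    k.rep u = x := rep_unique k (rep_spec k u) hx

/-- A conditional element is the composition of the canonical inclusion into the canonical model
and its canonical representation. -/
lemma incl_preimage_rep (k : Cond Y K) :
    (Stone.incl Y).comp (BaireSet.preimage k.rep) = k := by
  have key : ∀ (A : Set K) (_ : MeasurableSet[MeasurableSpace.generateFrom
      {A | ∃ (g : C(K, ℝ)) (c : ℝ), A = {x | g x ≤ c}}] A) (h : MeasurableSet[baire K] A),
      k.rep ⁻¹' A =ᵐ[Stone.measure Y] Stone.clopen (k ⟨A, h⟩) := by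
    intro A hA
    induction A, hA using MeasurableSpace.generateFrom_induction with
    | hC t ht _ =>
      obtain ⟨g, c, rfl⟩ := ht
      intro h
      change k.rep ⁻¹' {x | g x ≤ c} =ᵐ[Stone.measure Y] Stone.clopen (k (leSet g c))
      have hsub : Stone.clopen (k (leSet g c)) ⊆ k.rep ⁻¹' {x | g x ≤ c} :=
        fun u hu => rep_spec k u g c hu
      let s : ℕ → BaireSet K := fun n => (leSet g (c + 1 / ((n : ℝ) + 1)))ᶜ
      have hs : IsLUB (range s) (leSet g c)ᶜ := by
        rw [BaireSet.isLUB_iff]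
        change {x | g x ≤ c}ᶜ = ⋃ n : ℕ, {x | g x ≤ c + 1 / ((n : ℝ) + 1)}ᶜ
        ext x
        simp only [mem_compl_iff, mem_ofPred_eq, not_le, mem_iUnion]
        constructor
        · intro hx
          obtain ⟨n, hn⟩ := exists_nat_one_div_lt (sub_pos.2 hx)
          exact ⟨n, by linarith⟩
        · rintro ⟨n, hn⟩
          have h0 : (0 : ℝ) < 1 / ((n : ℝ) + 1) := by positivity
          linarith
      have hl := Stone.clopen_ae_eq_of_isLUB (k.isLUB hs)
      rw [map_compl', Stone.clopen_compl] at hl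
      have hl' := hl.compl
      rw [compl_compl] at hl'
      refine Filter.EventuallyLE.antisymm ?_ (LE.le.eventuallyLE hsub)
      refine Filter.EventuallyLE.trans (LE.le.eventuallyLE ?_) hl'.le
      intro u hu hun
      obtain ⟨n, hn⟩ := mem_iUnion.1 hun
      rw [map_compl', Stone.clopen_compl] at hn
      refine hn (mem_clopen_of_lt k (rep_spec k u) g ?_)
      have h0 : (0 : ℝ) < 1 / ((n : ℝ) + 1) := by positivity
      have h1 : g (k.rep u) ≤ c := hu
      linarith
    | empty =>
      intro h
      have : (⟨∅, h⟩ : BaireSet K) = ⊥ := rfl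
      rw [this, map_bot, Stone.clopen_bot]; rfl
    | compl t ht ih =>
      intro h
      have ht' : MeasurableSet[baire K] t := by rw [baire_eq_generateFrom]; exact ht
      have : (⟨tᶜ, h⟩ : BaireSet K) = (⟨t, ht'⟩ : BaireSet K)ᶜ := rfl
      rw [this, map_compl', Stone.clopen_compl]
      exact (ih ht').compl
    | iUnion t ht ih =>
      intro h
      have ht' : ∀ n, MeasurableSet[baire K] (t n) := fun n => by
        rw [baire_eq_generateFrom]; exact ht n
      have hl : IsLUB (range fun n => (⟨t n, ht' n⟩ : BaireSet K)) ⟨⋃ n, t n, h⟩ := by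
        rw [BaireSet.isLUB_iff]
      rw [preimage_iUnion]
      exact (Filter.EventuallyEq.countable_iUnion fun n => ih n (ht' n)).trans
        (Stone.clopen_ae_eq_of_isLUB (k.isLUB hl))
  ext A
  refine Stone.incl_eq (key A ?_ A.2)
  rw [← baire_eq_generateFrom]
  exact A.2

/-- The canonical bijection between the conditional elements of a compact Hausdorff space `K` over
`Y` and the continuous maps from the canonical model of `Y` to `K`. -/
def condEquiv (Y : ProbAlg.{u}) (K : Type v) [TopologicalSpace K] [CompactSpace K] [T2Space K] :
    Cond Y K ≃ C(Stone Y, K) where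
  toFun k := k.rep
  invFun F := (Stone.incl Y).comp (BaireSet.preimage F)
  left_inv k := incl_preimage_rep k
  right_inv F := by
    ext u
    refine rep_eq _ fun g c hu => ?_
    exact Stone.clopen_incl_subset (A := BaireSet.preimage F (leSet g c))
      (isClosed_le (g.continuous.comp F.continuous) continuous_const) hu

@[simp] lemma condEquiv_apply (k : Cond Y K) : condEquiv Y K k = k.rep := rfl

lemma rep_baseChange (k : Cond Y K) (T : X.Hom Y) (u : Stone X) :
    (k.baseChange T).rep u = k.rep (Stone.map T u) :=
  rep_eq _ fun g c hu => rep_spec k _ g c hu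

lemma rep_map [CompactSpace K'] [T2Space K'] (F : C(K, K')) (k : Cond Y K) (u : Stone Y) :
    (k.map F).rep u = F (k.rep u) :=
  rep_eq _ fun g c hu => rep_spec k u (g.comp F) c hu

/-- The group structure on the conditional elements of a compact Hausdorff group, transported
from the pointwise group structure on continuous maps on the canonical model. -/
instance [Group K] [IsTopologicalGroup K] : Group (Cond Y K) := (condEquiv Y K).group

@[simp] lemma rep_mul [Group K] [IsTopologicalGroup K] (a b : Cond Y K) :
    (a * b).rep = a.rep * b.rep := (condEquiv Y K).apply_symm_apply _

end Cond

/-! ### Passing from concrete probability spaces to probability algebras -/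

/-- Almost everywhere equality of measurable sets. -/
def aeSetoid {Ω : Type u} [MeasurableSpace Ω] (μ : Measure Ω) :
    Setoid (Subtype (MeasurableSet : Set Ω → Prop)) where
  r A B := (A : Set Ω) =ᵐ[μ] (B : Set Ω)
  iseqv := ⟨fun _ => Filter.EventuallyEq.rfl, fun h => h.symm, fun h h' => h.trans h'⟩

/-- The quotient of the `σ`-algebra of measurable sets by the null sets. -/
def MeasAlg {Ω : Type u} [MeasurableSpace Ω] (μ : Measure Ω) : Type u := Quotient (aeSetoid μ)

namespace MeasAlg

variable {Ω : Type u} [MeasurableSpace Ω] {μ : Measure Ω}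

/-- The class of a measurable set. -/
def mk (μ : Measure Ω) (A : Set Ω) (hA : MeasurableSet A) : MeasAlg μ :=
  Quotient.mk (aeSetoid μ) ⟨A, hA⟩

lemma ind {p : MeasAlg μ → Prop} (h : ∀ A hA, p (mk μ A hA)) (a : MeasAlg μ) : p a :=
  Quotient.ind (fun A => h A.1 A.2) a

lemma mk_eq_mk {A B : Set Ω} {hA : MeasurableSet A} {hB : MeasurableSet B} :
    mk μ A hA = mk μ B hB ↔ A =ᵐ[μ] B :=
  ⟨fun h => Quotient.exact h, fun h => Quotient.sound h⟩

instance : BooleanAlgebra (MeasAlg μ) where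
  le := Quotient.lift₂ (fun A B => (A : Set Ω) ≤ᵐ[μ] (B : Set Ω)) fun _ _ _ _ h h' =>
    propext ⟨fun H => h.symm.le.trans (H.trans h'.le), fun H => h.le.trans (H.trans h'.symm.le)⟩
  sup := Quotient.map₂ (fun A B => ⟨A ∪ B, A.2.union B.2⟩) fun _ _ h _ _ h' =>
    Filter.EventuallyEq.union h h'
  inf := Quotient.map₂ (fun A B => ⟨A ∩ B, A.2.inter B.2⟩) fun _ _ h _ _ h' =>
    Filter.EventuallyEq.inter h h'
  compl := Quotient.map (fun A => ⟨(A : Set Ω)ᶜ, A.2.compl⟩) fun _ _ h =>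
    Filter.EventuallyEq.compl h
  top := mk μ univ MeasurableSet.univ
  bot := mk μ ∅ MeasurableSet.empty
  le_refl a := by
    induction a using ind
    exact Filter.EventuallyLE.rfl
  le_trans a b c := by
    induction a using ind
    induction b using ind
    induction c using ind
    exact fun h h' => Filter.EventuallyLE.trans h h'
  le_antisymm a b := by
    induction a using ind
    induction b using ind
    exact fun h h' => mk_eq_mk.2 (Filter.EventuallyLE.antisymm h h')
  le_sup_left a b := by
    induction a using ind
    induction b using ind
    exact LE.le.eventuallyLE subset_union_left
  le_sup_right a b := by
    induction a using ind
    induction b using ind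
    exact LE.le.eventuallyLE subset_union_right
  sup_le a b c := by
    induction a using ind
    induction b using ind
    induction c using ind
    intro h h'
    filter_upwards [h, h'] with x hx hx' hxx
    exact hxx.elim hx hx'
  inf_le_left a b := by
    induction a using ind
    induction b using ind
    exact LE.le.eventuallyLE inter_subset_left
  inf_le_right a b := by
    induction a using ind
    induction b using ind
    exact LE.le.eventuallyLE inter_subset_right
  le_inf a b c := by
    induction a using ind
    induction b using ind
    induction c using ind
    intro h h'
    filter_upwards [h, h'] with x hx hx' hxx
    exact ⟨hx hxx, hx' hxx⟩
  le_sup_inf a b c := by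
    induction a using ind with | _ A
    induction b using ind with | _ B
    induction c using ind with | _ C
    exact LE.le.eventuallyLE (show (A ∪ B) ∩ (A ∪ C) ⊆ A ∪ B ∩ C by rw [union_inter_distrib_left])
  inf_compl_le_bot a := by
    induction a using ind with | _ A
    exact LE.le.eventuallyLE (show A ∩ Aᶜ ⊆ ∅ by rw [inter_compl_self])
  top_le_sup_compl a := by
    induction a using ind with | _ A
    exact LE.le.eventuallyLE (show univ ⊆ A ∪ Aᶜ by rw [union_compl_self])
  le_top a := by
    induction a using ind
    exact LE.le.eventuallyLE (subset_univ _)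
  bot_le a := by
    induction a using ind
    exact LE.le.eventuallyLE (empty_subset _)

lemma mk_le_mk {A B : Set Ω} {hA : MeasurableSet A} {hB : MeasurableSet B} :
    mk μ A hA ≤ mk μ B hB ↔ A ≤ᵐ[μ] B := Iff.rfl

lemma exists_mk (a : MeasAlg μ) : ∃ A hA, mk μ A hA = a := by
  induction a using ind with | _ A hA
  exact ⟨A, hA, rfl⟩

lemma isLUB_mk {s : ℕ → Set Ω} (hs : ∀ n, MeasurableSet (s n)) :
    IsLUB (range fun n => mk μ (s n) (hs n)) (mk μ (⋃ n, s n) (MeasurableSet.iUnion hs)) := by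
  constructor
  · rintro _ ⟨n, rfl⟩
    exact LE.le.eventuallyLE (subset_iUnion s n)
  · intro b hb
    induction b using ind with | _ B hB
    have h : ∀ᵐ x ∂μ, ∀ n, x ∈ s n → x ∈ B := ae_all_iff.2 fun n => hb ⟨n, rfl⟩
    refine mk_le_mk.2 ?_
    filter_upwards [h] with x hx hxs
    obtain ⟨n, hn⟩ := mem_iUnion.1 hxs
    exact hx n hn

end MeasAlg

/-- The probability algebra of a concrete probability space. -/
def toProbAlg {Ω : Type u} [MeasurableSpace Ω] (μ : Measure Ω) [IsProbabilityMeasure μ] :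
    ProbAlg.{u} where
  carrier := MeasAlg μ
  sigmaComplete s := by
    choose A hA h using fun n => MeasAlg.exists_mk (s n)
    obtain rfl : (fun n => MeasAlg.mk μ (A n) (hA n)) = s := funext h
    exact ⟨_, MeasAlg.isLUB_mk hA⟩
  μ := Quotient.lift (fun A => μ (A : Set Ω)) fun _ _ h => measure_congr h
  μ_bot := measure_empty
  μ_top := measure_univ
  μ_lub s a hd ha := by
    choose A hA h using fun n => MeasAlg.exists_mk (s n)
    obtain rfl : (fun n => MeasAlg.mk μ (A n) (hA n)) = s := funext h
    rw [ha.unique (MeasAlg.isLUB_mk hA)]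
    change μ (⋃ n, A n) = ∑' n, μ (A n)
    refine measure_iUnion₀ ?_ fun n => (hA n).nullMeasurableSet
    intro i j hij
    have h1 : MeasAlg.mk μ (A i ∩ A j) ((hA i).inter (hA j)) ≤
        MeasAlg.mk μ ∅ MeasurableSet.empty := disjoint_iff_inf_le.1 (hd hij)
    have h2 := ae_le_set.1 (MeasAlg.mk_le_mk.1 h1)
    rwa [sdiff_empty] at h2
  μ_pos a ha := by
    induction a using MeasAlg.ind with | _ A hA
    refine pos_iff_ne_zero.2 fun h => ha ?_
    exact MeasAlg.mk_eq_mk.2 (ae_eq_empty.2 h)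

/-- The morphism of probability algebras given by a measure preserving map. -/
def castHom {Ω : Type u} {Ω' : Type v} [MeasurableSpace Ω] [MeasurableSpace Ω'] {μ : Measure Ω}
    {ν : Measure Ω'} [IsProbabilityMeasure μ] [IsProbabilityMeasure ν] (F : Ω → Ω')
    (hF : MeasurePreserving F μ ν) : (toProbAlg μ).Hom (toProbAlg ν) where
  pullback :=
    { toFun := Quotient.map (fun A => ⟨F ⁻¹' (A : Set Ω'), hF.measurable A.2⟩) fun _ _ h =>
        hF.quasiMeasurePreserving.preimage_ae_eq h
      map_sup' := fun a b => by
        induction a using MeasAlg.ind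
        induction b using MeasAlg.ind
        rfl
      map_inf' := fun a b => by
        induction a using MeasAlg.ind
        induction b using MeasAlg.ind
        rfl
      map_top' := rfl
      map_bot' := rfl }
  map_μ E := by
    induction E using MeasAlg.ind with | _ A hA
    exact hF.measure_preimage hA.nullMeasurableSet

/-- The canonical isomorphism from the probability algebra of the canonical model of `Y` to `Y`
(in terms of Boolean algebras, `E ∈ Y` is sent to the class of the associated clopen set). -/
def ofStone (Y : ProbAlg.{u}) : (toProbAlg (Stone.measure Y)).Hom Y where
  pullback :=
    { toFun := fun E => MeasAlg.mk _ (Stone.clopen E) (Stone.measurableSet_clopen E)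
      map_sup' := fun E F => MeasAlg.mk_eq_mk.2 (by rw [Stone.clopen_sup]; rfl)
      map_inf' := fun E F => MeasAlg.mk_eq_mk.2 (by rw [Stone.clopen_inf]; rfl)
      map_top' := MeasAlg.mk_eq_mk.2 (by rw [Stone.clopen_top]; rfl)
      map_bot' := MeasAlg.mk_eq_mk.2 (by rw [Stone.clopen_bot]; rfl) }
  map_μ E := Stone.measure_clopen E

/-! ### Systems and extensions -/

/-- The endomorphisms of a probability algebra form a monoid under composition; its units are the
automorphisms. -/
instance (X : ProbAlg.{u}) : Monoid (X.Hom X) where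
  mul := ProbAlg.Hom.comp
  one := ProbAlg.Hom.id X
  mul_assoc _ _ _ := rfl
  one_mul _ := rfl
  mul_one _ := rfl

/-- A probability algebra system for the group `Γ`: a probability algebra with an action of `Γ` by
automorphisms (since `Γ` is a group, the values `T γ` are automatically invertible). -/
structure ProbAlgSys (Γ : Type w) [Group Γ] where
  /-- the underlying probability algebra -/
  space : ProbAlg.{u}
  /-- the action -/
  T : Γ →* space.Hom space

section Systems

variable {Γ : Type w} [Group Γ]

/-- Morphisms of systems. -/
structure ProbAlgSys.Hom (X : ProbAlgSys.{u₁} Γ) (Y : ProbAlgSys.{u₂} Γ)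
    where
  /-- the underlying morphism of probability algebras -/
  hom : X.space.Hom Y.space
  equivariant : ∀ γ, hom.comp (X.T γ) = (Y.T γ).comp hom

/-- An extension of the system `Y`. -/
structure Extension (Y : ProbAlgSys.{u} Γ) where
  /-- the extending system -/
  sys : ProbAlgSys.{v} Γ
  /-- the factor map -/
  π : sys.Hom Y

/-- Morphisms of extensions of `Y`. -/
structure Extension.Hom {Y : ProbAlgSys.{u} Γ} (X : Extension.{u, u₁} Y)
    (X' : Extension.{u, u₂} Y) where
  /-- the underlying morphism of systems -/
  map : X.sys.Hom X'.sys
  comm : X'.π.hom.comp map.hom = X.π.hom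

/-- Two extensions of `Y` are isomorphic (as extensions of `Y`). -/
def Extension.Isomorphic {Y : ProbAlgSys.{u} Γ} (X : Extension.{u, u₁} Y)
    (X' : Extension.{u, u₂} Y) : Prop :=
  ∃ (φ : X.Hom X') (ψ : X'.Hom X),
    ψ.map.hom.comp φ.map.hom = ProbAlg.Hom.id X.sys.space ∧
    φ.map.hom.comp ψ.map.hom = ProbAlg.Hom.id X'.sys.space

end Systems

/-! ### Homogeneous spaces of compact groups -/

section Groups

variable {K : Type v} [Group K] [TopologicalSpace K]

/-- The homogeneous space `K / L` of left cosets of the closed subgroup `L`. -/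
def Coset (L : ClosedSubgroup K) : Type v := K ⧸ L.toSubgroup

namespace Coset

variable (L : ClosedSubgroup K)

instance : TopologicalSpace (Coset L) := inferInstanceAs (TopologicalSpace (K ⧸ L.toSubgroup))

instance : MeasurableSpace (Coset L) := baire (Coset L)

instance : MulAction K (Coset L) := inferInstanceAs (MulAction K (K ⧸ L.toSubgroup))

/-- The coset `kL`. -/
def mk (k : K) : Coset L := QuotientGroup.mk (s := L.toSubgroup) k

lemma smul_mk (k k' : K) : k • mk L k' = mk L (k * k') := rfl

lemma continuous_mk : Continuous (mk L) := QuotientGroup.continuous_mk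

instance [CompactSpace K] : CompactSpace (Coset L) :=
  inferInstanceAs (CompactSpace (K ⧸ L.toSubgroup))

variable [IsTopologicalGroup K]

instance : T2Space (Coset L) :=
  have : IsClosed (L.toSubgroup : Set K) := L.isClosed'
  inferInstanceAs (T2Space (K ⧸ L.toSubgroup))

instance : ContinuousSMul K (Coset L) :=
  inferInstanceAs (ContinuousSMul K (K ⧸ L.toSubgroup))

end Coset

lemma measurable_mk (L : ClosedSubgroup K) :
    @Measurable K (Coset L) (borel K) _ (Coset.mk L) :=
  (measurable_baire_baire (Coset.continuous_mk L)).mono baire_le_borel le_rfl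

variable [IsTopologicalGroup K] [CompactSpace K]

/-- The Haar probability measure of a compact group, as a Borel measure. -/
def haarBorel (K : Type v) [Group K] [TopologicalSpace K] [IsTopologicalGroup K]
    [CompactSpace K] : @Measure K (borel K) :=
  letI : MeasurableSpace K := borel K
  haveI : BorelSpace K := ⟨rfl⟩
  Measure.haarMeasure (⊤ : TopologicalSpace.PositiveCompacts K)

/-- The Haar probability measure on `K / L`, on the Baire `σ`-algebra: the image of the Haar
probability measure of `K` under the projection `K → K / L`. -/
def haar (L : ClosedSubgroup K) : Measure (Coset L) :=
  letI : MeasurableSpace K := borel K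
  Measure.map (Coset.mk L) (haarBorel K)

instance (L : ClosedSubgroup K) : IsProbabilityMeasure (haar L) := by
  let _ : MeasurableSpace K := borel K
  have : BorelSpace K := ⟨rfl⟩
  have : IsProbabilityMeasure (haarBorel K) := ⟨by
    have h := Measure.haarMeasure_self (K₀ := (⊤ : TopologicalSpace.PositiveCompacts K))
    exact h⟩
  exact Measure.isProbabilityMeasure_map (measurable_mk L).aemeasurable

/-- The Haar measure on `K / L` is invariant under left translations. -/
lemma map_smul_haar (L : ClosedSubgroup K) (k : K) : (haar L).map (fun c => k • c) = haar L := by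
  let _ : MeasurableSpace K := borel K
  have : BorelSpace K := ⟨rfl⟩
  have hinv : Measure.map (fun x => k * x) (haarBorel K) = haarBorel K :=
    map_mul_left_eq_self (Measure.haarMeasure (⊤ : TopologicalSpace.PositiveCompacts K)) k
  have h1 : Measurable (fun c : Coset L => k • c) := measurable_baire_baire (continuous_const_smul k)
  have h2 : Measurable (fun x : K => k * x) := (continuous_const_mul k).measurable
  unfold haar
  rw [Measure.map_map h1 (measurable_mk L)]
  conv_rhs => rw [← hinv, Measure.map_map (measurable_mk L) h2]
  rfl

variable [T2Space K]

/-- The action of the conditional elements of `K` on the conditional elements of `K / L`. In terms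
of canonical representations it is given pointwise by the action of `K` on `K / L`; equivalently,
it is the action by left multiplication on the cosets `kL` of the conditional elements `k`
of `K`. -/
instance {X : ProbAlg.{u}} (L : ClosedSubgroup K) : SMul (Cond X K) (Cond X (Coset L)) where
  smul k t := (Cond.condEquiv X (Coset L)).symm ⟨fun u => k.rep u • t.rep u, by fun_prop⟩

lemma Cond.rep_smul {X : ProbAlg.{u}} {L : ClosedSubgroup K} (k : Cond X K)
    (t : Cond X (Coset L)) (u : Stone X) : (k • t).rep u = k.rep u • t.rep u := by
  have h : (k • t).rep = _ := (Cond.condEquiv X (Coset L)).apply_symm_apply _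
  rw [h]; rfl

end Groups

/-! ### Cocycles, skew-products and homogeneous extensions -/

section Skew

variable {Γ : Type w} [Group Γ] {K : Type v} [Group K] [TopologicalSpace K]
  [IsTopologicalGroup K] [CompactSpace K] [T2Space K]

/-- A `K`-valued cocycle on the system `Y`. -/
structure Cocycle (Y : ProbAlgSys.{u} Γ) (K : Type v) [Group K] [TopologicalSpace K]
    [IsTopologicalGroup K] [CompactSpace K] [T2Space K] where
  /-- the components of the cocycle -/
  ρ : Γ → Cond Y.space K
  cocycle_eq : ∀ γ γ', ρ (γ * γ') = (ρ γ).baseChange (Y.T γ') * ρ γ'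

namespace Cocycle

variable {Y : ProbAlgSys.{u} Γ} (ρ : Cocycle Y K)

lemma rep_mul (γ γ' : Γ) (u : Stone Y.space) :
    (ρ.ρ (γ * γ')).rep u = (ρ.ρ γ).rep (Stone.map (Y.T γ') u) * (ρ.ρ γ').rep u := by
  rw [ρ.cocycle_eq, Cond.rep_mul, ContinuousMap.mul_apply, Cond.rep_baseChange]

lemma rep_one (u : Stone Y.space) : (ρ.ρ 1).rep u = 1 := by
  have h := ρ.rep_mul 1 1 u
  rw [mul_one, map_one] at h
  exact (mul_eq_right.1 h.symm)

/-- The action of `γ` on the skew-product `Stone Y × K / L`,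
`(y, kL) ↦ (T^γ y, ρ_γ(y) k L)`, where `ρ_γ` is canonically represented by a continuous map. -/
def skewMap (L : ClosedSubgroup K) (γ : Γ) (p : Stone Y.space × Coset L) :
    Stone Y.space × Coset L :=
  (Stone.map (Y.T γ) p.1, (ρ.ρ γ).rep p.1 • p.2)

/-- The measure on the skew-product: the product of the measure of the canonical model and the
Haar measure. (By `baire_prod`, its domain is the Baire `σ`-algebra of the product space.) -/
def skewMeasure (Y : ProbAlgSys.{u} Γ) (L : ClosedSubgroup K) :
    Measure (Stone Y.space × Coset L) :=
  (Stone.measure Y.space).prod (haar L)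

instance (Y : ProbAlgSys.{u} Γ) (L : ClosedSubgroup K) :
    IsProbabilityMeasure (skewMeasure Y L) :=
  inferInstanceAs (IsProbabilityMeasure ((Stone.measure Y.space).prod (haar L)))

lemma measurePreserving_skewMap (L : ClosedSubgroup K) (γ : Γ) :
    MeasurePreserving (ρ.skewMap L γ) (skewMeasure Y L) (skewMeasure Y L) := by
  refine MeasurePreserving.skew_product (Stone.measurePreserving_map (Y.T γ))
    (g := fun y c => (ρ.ρ γ).rep y • c) ?_ (Filter.Eventually.of_forall fun y =>
      map_smul_haar L _)
  have hc : Continuous (Function.uncurry fun (y : Stone Y.space) (c : Coset L) =>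
      (ρ.ρ γ).rep y • c) := by
    unfold Function.uncurry
    fun_prop
  have h := measurable_baire_baire hc
  rw [baire_prod] at h
  exact h

lemma castHom_ext {Ω : Type u₁} {Ω' : Type u₂} [MeasurableSpace Ω] [MeasurableSpace Ω']
    {μ : Measure Ω} {ν : Measure Ω'} [IsProbabilityMeasure μ] [IsProbabilityMeasure ν]
    {F G : Ω → Ω'} (hF : MeasurePreserving F μ ν) (hG : MeasurePreserving G μ ν) (h : F = G) :
    castHom F hF = castHom G hG := by
  subst h; rfl

/-- The homogeneous skew-product of the system `Y` with `K / L` along the cocycle `ρ`, as a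
system of probability algebras. -/
def skewSys (L : ClosedSubgroup K) : ProbAlgSys.{max u v} Γ where
  space := toProbAlg (skewMeasure Y L)
  T :=
    { toFun := fun γ => castHom (ρ.skewMap L γ) (ρ.measurePreserving_skewMap L γ)
      map_one' := by
        have h : ρ.skewMap L 1 = fun p => p := by
          funext p
          refine Prod.ext ?_ ?_
          · change Stone.map (Y.T 1) p.1 = p.1
            rw [map_one]; rfl
          · change (ρ.ρ 1).rep p.1 • p.2 = p.2
            rw [rep_one, one_smul]
        rw [castHom_ext _ (MeasurePreserving.id _) h]
        ext E
        induction E using MeasAlg.ind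
        rfl
      map_mul' := fun γ γ' => by
        have h : ρ.skewMap L (γ * γ') = ρ.skewMap L γ ∘ ρ.skewMap L γ' := by
          funext p
          refine Prod.ext ?_ ?_
          · change Stone.map (Y.T (γ * γ')) p.1 = Stone.map (Y.T γ) (Stone.map (Y.T γ') p.1)
            rw [map_mul]; rfl
          · change (ρ.ρ (γ * γ')).rep p.1 • p.2 =
              (ρ.ρ γ).rep (Stone.map (Y.T γ') p.1) • ((ρ.ρ γ').rep p.1 • p.2)
            rw [rep_mul, mul_smul]
        rw [castHom_ext _ ((ρ.measurePreserving_skewMap L γ).comp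
          (ρ.measurePreserving_skewMap L γ')) h]
        ext E
        induction E using MeasAlg.ind
        rfl }

/-- The homogeneous skew-product of the system `Y` with `K / L` along the cocycle `ρ`, as an
extension of `Y`; the factor map is the projection to the canonical model of `Y`, followed by the
canonical isomorphism. -/
def skewProduct (L : ClosedSubgroup K) : Extension.{u, max u v} Y where
  sys := ρ.skewSys L
  π :=
    { hom := (ofStone Y.space).comp (castHom (μ := skewMeasure Y L) Prod.fst measurePreserving_fst)
      equivariant := fun _ => rfl }

end Cocycle

/-- A `σ`-subalgebra of a Boolean algebra: a subset that contains the least element and is closed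
under complements and countable joins. -/
structure IsSigmaSubalgebra {B : Type u} [BooleanAlgebra B] (S : Set B) : Prop where
  bot_mem : ⊥ ∈ S
  compl_mem : ∀ a ∈ S, aᶜ ∈ S
  lub_mem : ∀ (s : ℕ → B) (a : B), (∀ n, s n ∈ S) → IsLUB (range s) a → a ∈ S

/-- A homogeneous extension `(X, π, θ, ρ)` of the system `Y` by `K / L`. -/
structure HomogeneousExtension (Y : ProbAlgSys.{u} Γ) (L : ClosedSubgroup K)
    extends Extension.{u, u₁} Y where
  /-- the vertical coordinate -/
  θ : Cond sys.space (Coset L)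
  /-- the cocycle -/
  ρ : Cocycle Y K
  generates : ∀ S : Set sys.space, IsSigmaSubalgebra S → range π.hom.inc ⊆ S → range θ ⊆ S → S = univ
  θ_equivariant : ∀ γ, θ.baseChange (sys.T γ) = (ρ.ρ γ).baseChange π.hom • θ

end Skew

/-! ### Bounded functions and integrals -/

/-- The space `L^∞(Y)` of a probability algebra, defined through the canonical model. -/
abbrev Linfty (Y : ProbAlg.{u}) : Type u := Lp ℂ ∞ (Stone.measure Y)

/-- The integral of a function in `L^∞(Y)`, or of any product of such functions, is taken over the
canonical model. -/
def ProbAlg.integral (Y : ProbAlg.{u}) (f : Stone Y → ℂ) : ℂ := ∫ y, f y ∂(Stone.measure Y)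

/-- The pullback `π^* f = f ∘ Stone(π)`. -/
def Linfty.pullback {X : ProbAlg.{u₁}} {Y : ProbAlg.{u₂}} (T : X.Hom Y) (f : Linfty Y) :
    Linfty X :=
  Lp.compMeasurePreserving (Stone.map T) (Stone.measurePreserving_map T) f

lemma Cond.memLp_comp {X : ProbAlg.{u}} {K : Type v} [TopologicalSpace K] [CompactSpace K]
    [T2Space K] (g : C(K, ℂ)) (k : Cond X K) :
    MemLp (fun x => g (k.rep x)) ∞ (Stone.measure X) := by
  have hre : Measurable fun x => (g (k.rep x)).re :=
    measurable_baire_of_continuous ⟨fun x => (g (k.rep x)).re, by fun_prop⟩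
  have him : Measurable fun x => (g (k.rep x)).im :=
    measurable_baire_of_continuous ⟨fun x => (g (k.rep x)).im, by fun_prop⟩
  have hm : Measurable fun x => g (k.rep x) := measurable_of_re_im hre him
  exact memLp_top_of_bound hm.aestronglyMeasurable ‖g‖
    (Filter.Eventually.of_forall fun x => g.norm_coe_le_norm _)

/-- The function `g ∘ k`, for `g ∈ C(K)` and a conditional element `k` of a compact Hausdorff space
`K`, as an element of `L^∞`. The canonical representation of the conditional element `g ∘ k` is the
composition of `g` with the canonical representation of `k` (see `Cond.rep_map`). -/
def Cond.compLinfty {X : ProbAlg.{u}} {K : Type v} [TopologicalSpace K] [CompactSpace K]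
    [T2Space K] (g : C(K, ℂ)) (k : Cond X K) : Linfty X :=
  (Cond.memLp_comp g k).toLp

end MackeyZimmer

end

open MackeyZimmer

/-!
Put `F(x) = (π(x), θ(x))`, a continuous map from the canonical model of `X` to
`Stone Y × K / L`, where `π` and `θ` stand for their canonical representations. Three facts make
`F` an isomorphism onto the skew-product after passing to probability algebras.

* The hypothesis, applied to indicator functions of clopen sets, says that for each element `E`
  of `Y` the measure `A ↦ μ(π⁻¹ E ∩ θ⁻¹ A)` integrates continuous functions on `K / L` like the
  multiple `μ(E) · haar`. Finite Baire measures are determined by such integrals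
  (`ext_of_integral_continuous_baire`), so the image of the measure of `X` under `F` agrees with
  the product measure on rectangles, and `F` is measure preserving.
* The equivariance of `π` and of `θ` says that `F` intertwines the actions pointwise
  (`HomogeneousExtension.skewCoord_map`).
* A measure preserving homomorphism of probability algebras is injective, and its range is a
  `σ`-subalgebra. The range of the homomorphism of `F` contains the ranges of `π^*` and `θ`, so it
  is everything because these generate; hence the homomorphism is invertible
  (`ProbAlg.Hom.exists_inverse`), and the inverse inherits the compatibilities.
-/

namespace MackeyZimmer

/-! ### Finite Baire measures -/

/-- Finite Baire measures are determined by the integrals of continuous functions. No regularity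
or metrizability of `K` is needed: a Baire measure is determined by its images under continuous
real functions, which are Borel measures on `ℝ`. -/
lemma ext_of_integral_continuous_baire {K : Type*} [TopologicalSpace K]
    {μ ν : @Measure K (baire K)} [IsFiniteMeasure μ] [IsFiniteMeasure ν]
    (h : ∀ g : C(K, ℝ), ∫ x, g x ∂μ = ∫ x, g x ∂ν) : μ = ν := by
  let _ : MeasurableSpace K := baire K
  have hle : ∀ (g : C(K, ℝ)) (c : ℝ), μ {x | g x ≤ c} = ν {x | g x ≤ c} := by
    intro g c
    have hg : Measurable g := measurable_baire_of_continuous g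
    have hmap : μ.map g = ν.map g := by
      refine ext_of_forall_integral_eq_of_IsFiniteMeasure fun f => ?_
      rw [integral_map hg.aemeasurable f.continuous.aestronglyMeasurable,
        integral_map hg.aemeasurable f.continuous.aestronglyMeasurable]
      exact h (f.toContinuousMap.comp g)
    have h1 := congrArg (fun m => m (Iic c)) hmap
    rwa [Measure.map_apply hg measurableSet_Iic, Measure.map_apply hg measurableSet_Iic] at h1
  refine ext_of_generate_finite _ baire_eq_generateFrom ?_ ?_ ?_
  · rintro _ ⟨g, c, rfl⟩ _ ⟨g', c', rfl⟩ _
    refine ⟨(g - ContinuousMap.const K c) ⊔ (g' - ContinuousMap.const K c'), 0, ?_⟩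
    ext x
    simp
  · rintro _ ⟨g, c, rfl⟩
    exact hle g c
  · simpa using hle 0 0

/-! ### Morphisms of probability algebras -/

namespace ProbAlg.Hom

variable {X : ProbAlg.{u₁}} {Y : ProbAlg.{u₂}}

lemma pullback_injective (T : X.Hom Y) : Function.Injective T.pullback := by
  have key : ∀ a b, T.pullback a ≤ T.pullback b → a ≤ b := by
    intro a b h
    rw [← sdiff_eq_bot_iff] at h ⊢
    apply eq_bot_of_μ
    rw [← T.map_μ, map_sdiff', h, X.μ_bot]
  exact fun a b h => le_antisymm (key a b h.le) (key b a h.ge)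

lemma isSigmaSubalgebra_range (T : X.Hom Y) : IsSigmaSubalgebra (range T.inc) where
  bot_mem := ⟨⊥, map_bot T.inc⟩
  compl_mem := by
    rintro _ ⟨a, rfl⟩
    exact ⟨aᶜ, map_compl' T.inc a⟩
  lub_mem s a hs ha := by
    choose t ht using hs
    obtain rfl : (fun n => T.inc (t n)) = s := funext ht
    obtain ⟨b, hb⟩ := Y.sigmaComplete t
    exact ⟨b, (T.inc.isLUB hb).unique ha⟩

/-- A morphism whose homomorphism of Boolean algebras is surjective is an isomorphism. -/
lemma exists_inverse (T : X.Hom Y) (hT : Function.Surjective T.pullback) :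
    ∃ S : Y.Hom X, S.comp T = id X ∧ T.comp S = id Y := by
  choose g hg using hT
  have hg' : ∀ b, g (T.pullback b) = b := fun b => T.pullback_injective (hg _)
  refine ⟨⟨{ toFun := g
             map_sup' := fun a b => T.pullback_injective (by simp only [map_sup, hg])
             map_inf' := fun a b => T.pullback_injective (by simp only [map_inf, hg])
             map_top' := T.pullback_injective (by rw [hg, map_top])
             map_bot' := T.pullback_injective (by rw [hg, map_bot]) },
           fun E => ?_⟩, ?_, ?_⟩
  · change Y.μ (g E) = X.μ E
    rw [← T.map_μ, hg]
  · ext E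
    exact hg E
  · ext E
    exact hg' E

end ProbAlg.Hom

/-- The canonical isomorphism from `X` to the probability algebra of its canonical model, inverse
to `ofStone X`: the class of a Baire set is sent to the element whose clopen set represents it. -/
noncomputable def toStone (X : ProbAlg.{u}) : X.Hom (toProbAlg (Stone.measure X)) where
  pullback :=
    { toFun := Quotient.lift (fun A : BaireSet (Stone X) => Stone.incl X A) fun A B h =>
        Stone.incl_eq (Filter.EventuallyEq.trans h (Stone.ae_eq_incl B))
      map_sup' := fun a b => by
        induction a using MeasAlg.ind
        induction b using MeasAlg.ind
        exact map_sup (Stone.incl X) _ _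
      map_inf' := fun a b => by
        induction a using MeasAlg.ind
        induction b using MeasAlg.ind
        exact map_inf (Stone.incl X) _ _
      map_top' := map_top (Stone.incl X)
      map_bot' := map_bot (Stone.incl X) }
  map_μ E := by
    induction E using MeasAlg.ind with | _ A hA
    exact (Stone.measure_clopen _).symm.trans (measure_congr (Stone.ae_eq_incl ⟨A, hA⟩).symm)

/-- Naturality of the passage from a probability algebra to its canonical model. -/
lemma pullback_incl {X : ProbAlg.{u₁}} {Y : ProbAlg.{u₂}} (T : X.Hom Y) (A : BaireSet (Stone Y)) :
    T.pullback (Stone.incl Y A) = Stone.incl X (BaireSet.preimage (Stone.map T) A) := by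
  refine (Stone.incl_eq ?_).symm
  have h := (Stone.measurePreserving_map T).quasiMeasurePreserving.preimage_ae_eq
    (Stone.ae_eq_incl A)
  exact h

/-! ### The coordinates of a homogeneous extension -/

namespace HomogeneousExtension

variable {Γ : Type w} [Group Γ] {K : Type v} [Group K] [TopologicalSpace K]
  [IsTopologicalGroup K] [CompactSpace K] [T2Space K] {L : ClosedSubgroup K} {Y : ProbAlgSys.{u} Γ}
  (X : HomogeneousExtension.{u, v, w, u₁} Y L)

/-- The map `x ↦ (π(x), θ(x))` from the canonical model of a homogeneous extension to the space
carrying the skew-product. -/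
noncomputable def skewCoord (x : Stone X.sys.space) : Stone Y.space × Coset L :=
  (Stone.map X.π.hom x, X.θ.rep x)

lemma measurable_rep_θ : Measurable X.θ.rep := measurable_baire_baire X.θ.rep.continuous

lemma measurable_skewCoord : Measurable X.skewCoord :=
  (Stone.measurePreserving_map X.π.hom).measurable.prodMk X.measurable_rep_θ

lemma skewCoord_map (γ : Γ) (x : Stone X.sys.space) :
    X.skewCoord (Stone.map (X.sys.T γ) x) = X.ρ.skewMap L γ (X.skewCoord x) := by
  refine Prod.ext ?_ ?_
  · change Stone.map (X.π.hom.comp (X.sys.T γ)) x = Stone.map ((Y.T γ).comp X.π.hom) x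
    rw [X.π.equivariant γ]
  · change X.θ.rep (Stone.map (X.sys.T γ) x) =
      (X.ρ.ρ γ).rep (Stone.map X.π.hom x) • X.θ.rep x
    rw [← Cond.rep_baseChange, X.θ_equivariant γ, Cond.rep_smul, Cond.rep_baseChange]

variable {X}

section Criterion

variable (hX : ∀ (f : Linfty Y.space) (g : C(Coset L, ℂ)),
  X.sys.space.integral (fun x => Linfty.pullback X.π.hom f x * X.θ.compLinfty g x) =
    Y.space.integral f * ∫ c, g c ∂(haar L))
include hX

/-- The product formula for the indicator function of a clopen set. -/
lemma setIntegral_rep_θ (E : Y.space) (g : C(Coset L, ℝ)) :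
    ∫ x in Stone.clopen (X.π.hom.pullback E), g (X.θ.rep x) ∂(Stone.measure X.sys.space) =
      (Stone.measure Y.space).real (Stone.clopen E) * ∫ c, g c ∂(haar L) := by
  let gC : C(Coset L, ℂ) := ⟨fun c => (g c : ℂ), by fun_prop⟩
  let f : Linfty Y.space :=
    indicatorConstLp ∞ (Stone.measurableSet_clopen E) (measure_ne_top _ _) (1 : ℂ)
  have hf : f =ᵐ[Stone.measure Y.space] (Stone.clopen E).indicator fun _ => (1 : ℂ) :=
    indicatorConstLp_coeFn
  have hTf : Linfty.pullback X.π.hom f =ᵐ[Stone.measure X.sys.space]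
      (Stone.clopen (X.π.hom.pullback E)).indicator fun _ => (1 : ℂ) := by
    have hmp := Stone.measurePreserving_map X.π.hom
    have h1 : Linfty.pullback X.π.hom f =ᵐ[Stone.measure X.sys.space] f ∘ Stone.map X.π.hom :=
      Lp.coeFn_compMeasurePreserving f hmp
    have h2 : f ∘ Stone.map X.π.hom =ᵐ[Stone.measure X.sys.space]
        ((Stone.clopen E).indicator fun _ => (1 : ℂ)) ∘ Stone.map X.π.hom :=
      hmp.quasiMeasurePreserving.ae_eq_comp hf
    refine h1.trans (h2.trans (Filter.EventuallyEq.of_eq ?_))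
    ext x
    exact indicator_comp_right (s := Stone.clopen E) (g := fun _ => (1 : ℂ)) (Stone.map X.π.hom)
  have hg : X.θ.compLinfty gC =ᵐ[Stone.measure X.sys.space] fun x => (g (X.θ.rep x) : ℂ) :=
    (Cond.memLp_comp gC X.θ).coeFn_toLp
  have h := hX f gC
  have hl : X.sys.space.integral (fun x => Linfty.pullback X.π.hom f x * X.θ.compLinfty gC x) =
      ((∫ x in Stone.clopen (X.π.hom.pullback E), g (X.θ.rep x)
        ∂(Stone.measure X.sys.space) : ℝ) : ℂ) := by
    rw [← integral_complex_ofReal, ← integral_indicator (Stone.measurableSet_clopen _)]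
    refine integral_congr_ae ?_
    filter_upwards [hTf, hg] with x h1 h2
    rw [h1, h2]
    by_cases hx : x ∈ Stone.clopen (X.π.hom.pullback E) <;> simp [hx]
  have hr : Y.space.integral f = ((Stone.measure Y.space).real (Stone.clopen E) : ℂ) := by
    refine (integral_congr_ae hf).trans ?_
    rw [integral_indicator_const _ (Stone.measurableSet_clopen E)]
    simp
  rw [hl, hr] at h
  have hgC : ∫ c, gC c ∂(haar L) = ((∫ c, g c ∂(haar L) : ℝ) : ℂ) := integral_complex_ofReal
  rw [hgC] at h
  exact_mod_cast h

lemma measure_clopen_inter_rep_θ (E : Y.space) {A : Set (Coset L)} (hA : MeasurableSet A) :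
    Stone.measure X.sys.space (Stone.clopen (X.π.hom.pullback E) ∩ X.θ.rep ⁻¹' A) =
      Stone.measure Y.space (Stone.clopen E) * haar L A := by
  have hm := X.measurable_rep_θ
  have key : ((Stone.measure X.sys.space).restrict
      (Stone.clopen (X.π.hom.pullback E))).map X.θ.rep =
      Stone.measure Y.space (Stone.clopen E) • haar L := by
    have : IsFiniteMeasure (Stone.measure Y.space (Stone.clopen E) • haar L) :=
      Measure.smul_finite _ (measure_ne_top _ _)
    refine ext_of_integral_continuous_baire fun g => ?_
    rw [integral_map hm.aemeasurable
      (measurable_baire_of_continuous g).aestronglyMeasurable, integral_smul_measure,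
      setIntegral_rep_θ hX]
    rfl
  have h := congrArg (fun m => m A) key
  rw [Measure.map_apply hm hA, Measure.restrict_apply (hm hA)] at h
  rwa [inter_comm]

lemma measurePreserving_skewCoord :
    MeasurePreserving X.skewCoord (Stone.measure X.sys.space) (Cocycle.skewMeasure Y L) := by
  refine ⟨X.measurable_skewCoord, ?_⟩
  refine (Measure.prod_eq_generateFrom (C := range (Stone.clopen (Y := Y.space)))
    (D := {A : Set (Coset L) | MeasurableSet A})
    Stone.baire_eq_generateFrom_clopen.symm MeasurableSpace.generateFrom_measurableSet
    ?_ MeasurableSpace.isPiSystem_measurableSet ?_ (haar L).toFiniteSpanningSetsIn ?_).symm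
  · rintro _ ⟨E, rfl⟩ _ ⟨F, rfl⟩ _
    exact ⟨E ⊓ F, Stone.clopen_inf E F⟩
  · exact ⟨fun _ => univ, fun _ => ⟨⊤, Stone.clopen_top⟩, fun _ => measure_lt_top _ _,
      iUnion_const _⟩
  · rintro _ ⟨E, rfl⟩ A hA
    rw [Measure.map_apply X.measurable_skewCoord ((Stone.measurableSet_clopen E).prod hA)]
    exact measure_clopen_inter_rep_θ hX E hA

end Criterion

/-! ### The comparison with the skew-product -/

variable (hF : MeasurePreserving X.skewCoord (Stone.measure X.sys.space) (Cocycle.skewMeasure Y L))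

variable (X) in
/-- The morphism from a homogeneous extension to the skew-product that is given by the map
`skewCoord` on the canonical model. -/
noncomputable def toSkewHom : X.sys.space.Hom (X.ρ.skewSys L).space :=
  (castHom X.skewCoord hF).comp (toStone X.sys.space)

lemma toSkewHom_comm : (X.ρ.skewProduct L).π.hom.comp (X.toSkewHom hF) = X.π.hom := by
  ext E
  exact Stone.incl_eq (E := X.π.hom.pullback E) Filter.EventuallyEq.rfl

lemma toSkewHom_equivariant (γ : Γ) :
    (X.toSkewHom hF).comp (X.sys.T γ) = ((X.ρ.skewSys L).T γ).comp (X.toSkewHom hF) := by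
  ext E
  induction E using MeasAlg.ind with | _ A hA
  refine (pullback_incl (X.sys.T γ) ⟨X.skewCoord ⁻¹' A, X.measurable_skewCoord hA⟩).trans ?_
  change _ = Stone.incl X.sys.space ⟨X.skewCoord ⁻¹' (X.ρ.skewMap L γ ⁻¹' A), _⟩
  congr 1
  apply Subtype.ext
  ext x
  change X.skewCoord (Stone.map (X.sys.T γ) x) ∈ A ↔ X.ρ.skewMap L γ (X.skewCoord x) ∈ A
  rw [X.skewCoord_map]

lemma toSkewHom_surjective : Function.Surjective (X.toSkewHom hF).pullback := by
  rw [← range_eq_univ]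
  refine X.generates _ (X.toSkewHom hF).isSigmaSubalgebra_range ?_ ?_
  · rintro _ ⟨E, rfl⟩
    exact ⟨(X.ρ.skewProduct L).π.hom.pullback E,
      congrArg (fun T : X.sys.space.Hom Y.space => T.pullback E) (X.toSkewHom_comm hF)⟩
  · rintro _ ⟨A, rfl⟩
    refine ⟨MeasAlg.mk _ (Prod.snd ⁻¹' (A : Set (Coset L))) (measurable_snd A.2), ?_⟩
    exact congrArg (fun k : Cond X.sys.space (Coset L) => k A) (Cond.incl_preimage_rep X.θ)

end HomogeneousExtension

/-- A morphism of extensions whose homomorphism of Boolean algebras is surjective is an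
isomorphism: the inverse is again equivariant and over the base. -/
lemma Extension.Hom.isomorphic {Γ : Type w} [Group Γ] {Y : ProbAlgSys.{u} Γ}
    {X : Extension.{u, u₁} Y} {X' : Extension.{u, u₂} Y} (φ : X.Hom X')
    (hφ : Function.Surjective φ.map.hom.pullback) : X.Isomorphic X' := by
  obtain ⟨S, hS, hS'⟩ := φ.map.hom.exists_inverse hφ
  refine ⟨φ, ⟨⟨S, fun γ => ?_⟩, ?_⟩, hS, hS'⟩
  · calc S.comp (X'.sys.T γ)
        = (S.comp (X'.sys.T γ)).comp (φ.map.hom.comp S) := by rw [hS']; rfl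
      _ = (S.comp ((X'.sys.T γ).comp φ.map.hom)).comp S := rfl
      _ = (S.comp (φ.map.hom.comp (X.sys.T γ))).comp S := by rw [φ.map.equivariant]
      _ = ((S.comp φ.map.hom).comp (X.sys.T γ)).comp S := rfl
      _ = (X.sys.T γ).comp S := by rw [hS]; rfl
  · rw [← φ.comm]
    change X'.π.hom.comp (φ.map.hom.comp S) = X'.π.hom
    rw [hS']
    rfl

end MackeyZimmer

theorem proposition4p3 {Γ : Type w} [Group Γ]
    {K : Type v} [Group K] [TopologicalSpace K] [IsTopologicalGroup K] [CompactSpace K] [T2Space K]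
    (L : ClosedSubgroup K) (Y : ProbAlgSys.{u} Γ) (X : HomogeneousExtension.{u, v, w, u₁} Y L)
    (hX : ∀ (f : Linfty Y.space) (g : C(Coset L, ℂ)),
      X.sys.space.integral (fun x => Linfty.pullback X.π.hom f x * X.θ.compLinfty g x) =
        Y.space.integral f * ∫ c, g c ∂(haar L)) :
    X.toExtension.Isomorphic (X.ρ.skewProduct L) := by
  have hF := HomogeneousExtension.measurePreserving_skewCoord hX
  exact Extension.Hom.isomorphic
    ⟨⟨X.toSkewHom hF, X.toSkewHom_equivariant hF⟩, X.toSkewHom_comm hF⟩ (X.toSkewHom_surjective hF)
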